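/- Let $T$ be the $3$-regular rooted tree, whose vertices are the finite words over $\{0,1,2\}$ (two words being adjacent if one is obtained from the other by appending a letter). Let $a$ be the automorphism of $T$ that permutes the three first-level subtrees cyclically, $xw\mapsto (x+1 \bmod 3)\,w$, and let $b=(a,a^{-1},b)$ be the automorphism of $T$ that fixes the first level and is defined recursively by acting as $a$ on the subtree rooted at $0$, as $a^{-1}$ on the subtree rooted at $1$, and as $b$ on the subtree rooted at $2$ (each subtree being identified with $T$). Let $G=\langle a,b\rangle\le\operatorname{Aut}T$ be the Gupta–Sidki $3$-group. Then every infinite finitely generated subgroup $H$ of $G$ is (abstractly) commensurable with $G$ or with $G\times G$; that is, $H$ has a finite-index subgroup which is isomorphic to a finite-index subgroup of $G$ or of $G\times G$. -/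

import Mathlib

/-- Two groups are (abstractly) commensurable if they have isomorphic subgroups of finite index. -/
def AbstractlyCommensurable (H K : Type*) [Group H] [Group K] : Prop :=
  ∃ (A : Subgroup H) (B : Subgroup K), A.FiniteIndex ∧ B.FiniteIndex ∧ Nonempty (A ≃* B)

namespace GuptaSidki

/-- The vertices of the 3-regular rooted tree: finite words over the alphabet `{0, 1, 2}`.
The root is the empty word. -/
abbrev Vertex : Type := List (Fin 3)

/-- The 3-regular rooted tree: two words are adjacent if one is obtained from the other by
appending one letter. -/
def tree : SimpleGraph Vertex where
  Adj u v := (∃ x : Fin 3, v = u ++ [x]) ∨ (∃ x : Fin 3, u = v ++ [x])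
  symm := ⟨fun _ _ h => h.symm⟩
  loopless := ⟨fun u h => by
    rcases h with ⟨x, hx⟩ | ⟨x, hx⟩ <;> simpa using congrArg List.length hx⟩

/-- The group of automorphisms of the 3-regular rooted tree (the root is fixed automatically,
being the only vertex of degree 3). -/
abbrev TreeAut : Type := tree ≃g tree

/-- A permutation of the vertices which, together with its inverse, maps words extended by a
letter to words extended by a letter, is an automorphism of the tree. -/
def mkAut (f g : Vertex → Vertex) (hgf : Function.LeftInverse g f)
    (hfg : Function.RightInverse g f)
    (hf : ∀ u x, ∃ y, f (u ++ [x]) = f u ++ [y])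
    (hg : ∀ u x, ∃ y, g (u ++ [x]) = g u ++ [y]) : TreeAut where
  toFun := f
  invFun := g
  left_inv := hgf
  right_inv := hfg
  map_rel_iff' := by
    have key : ∀ k : Vertex → Vertex, (∀ u x, ∃ y, k (u ++ [x]) = k u ++ [y]) →
        ∀ u v, tree.Adj u v → tree.Adj (k u) (k v) := by
      rintro k hk u v (⟨x, rfl⟩ | ⟨x, rfl⟩)
      · exact Or.inl (hk u x)
      · exact Or.inr (hk v x)
    intro u v
    refine ⟨fun h => ?_, key f hf u v⟩
    have h2 := key g hg _ _ h
    simpa only [Equiv.coe_fn_mk, hgf u, hgf v] using h2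

/-- Add `c` (mod 3) to the first letter of a word. -/
def rot (c : Fin 3) : Vertex → Vertex
  | [] => []
  | x :: w => (x + c) :: w

theorem rot_rot (c d : Fin 3) (h : c + d = 0) (u : Vertex) : rot d (rot c u) = u := by
  cases u with
  | nil => rfl
  | cons x w => simp [rot, add_assoc, h]

theorem rot_append (c : Fin 3) (u : Vertex) (x : Fin 3) :
    ∃ y, rot c (u ++ [x]) = rot c u ++ [y] := by
  cases u with
  | nil => exact ⟨x + c, rfl⟩
  | cons z w => exact ⟨x, rfl⟩

/-- The map fixing the first layer, acting as `rot c` on the subtree rooted at `0`, as `rot d` on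
the subtree rooted at `1`, and, recursively, as itself on the subtree rooted at `2`. -/
def dir (c d : Fin 3) : Vertex → Vertex
  | [] => []
  | 0 :: w => 0 :: rot c w
  | 1 :: w => 1 :: rot d w
  | 2 :: w => 2 :: dir c d w

theorem dir_dir (c d : Fin 3) (h : c + d = 0) (u : Vertex) : dir d c (dir c d u) = u := by
  induction u with
  | nil => rfl
  | cons x w ih =>
    have h' : d + c = 0 := by rw [add_comm, h]
    fin_cases x
    · simp [dir, rot_rot c d h]
    · simp [dir, rot_rot d c h']
    · simpa [dir] using ih

theorem dir_append (c d : Fin 3) (u : Vertex) (x : Fin 3) :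
    ∃ y, dir c d (u ++ [x]) = dir c d u ++ [y] := by
  induction u with
  | nil => fin_cases x <;> exact ⟨_, rfl⟩
  | cons z w ih =>
    fin_cases z
    · obtain ⟨y, hy⟩ := rot_append c w x
      exact ⟨y, by simp [dir, hy]⟩
    · obtain ⟨y, hy⟩ := rot_append d w x
      exact ⟨y, by simp [dir, hy]⟩
    · obtain ⟨y, hy⟩ := ih
      exact ⟨y, by simp [dir, hy]⟩

/-- The automorphism `a` permuting the first-level subtrees cyclically: `x w ↦ (x + 1) w`. -/
def a : TreeAut :=
  mkAut (rot 1) (rot 2) (rot_rot 1 2 rfl) (rot_rot 2 1 rfl) (rot_append 1) (rot_append 2)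

/-- The automorphism `b = (a, a⁻¹, b)`. -/
def b : TreeAut :=
  mkAut (dir 1 2) (dir 2 1) (dir_dir 1 2 rfl) (dir_dir 2 1 rfl) (dir_append 1 2) (dir_append 2 1)

theorem b_nil : b [] = [] := rfl

theorem b_zero (w : Vertex) : b (0 :: w) = 0 :: a w := rfl

theorem b_one (w : Vertex) : b (1 :: w) = 1 :: a⁻¹ w := rfl

theorem b_two (w : Vertex) : b (2 :: w) = 2 :: b w := rfl

/-- The Gupta–Sidki 3-group `G = ⟨a, b⟩`. -/
def G : Subgroup TreeAut := Subgroup.closure {a, b}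

end GuptaSidki

/-! # Finitely generated subgroups of the Gupta–Sidki group up to commensurability -/

/-! Call a class of subgroups of G inductive if it contains the finite subgroups and G, is stable
under conjugation, and contains H as soon as it contains the three first-level sections of H. The
theorem rests on two facts: every finitely generated subgroup lies in every inductive class
(`IsInductive.mem_of_fg`), and the subgroups commensurable with a finite power of G form an
inductive class (`isInductive_isVirtualPower`). Moreover the stabilizer of the first level has
finite index both in G and, through its sections, in G³; so Gⁿ with n ≥ 1 is commensurable with G or
G × G according to the parity of n, and n = 0 is the case of finite H.

For the first fact, H is realized as the group of labels of closed walks in a graph with finitely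
many b-edges, cut out of the Schreier graph of G/H. Taking sections replaces the graph by
`sectionGraph`, which has equally many b-edges because b = (a, a⁻¹, b) has a single section b. The
main induction is on this number. When it does not drop, either a loop group is finite
(`mem_of_stabilizing`), or walks, measured by their b-edges, get shorter in the section graph until
a and b are both labels of closed walks at one vertex and the loop group is G.

For the second fact, G is regular branch over G' (`commutator_le_copyAt`), so every nontrivial
normal subgroup contains a level stabilizer (`exists_levelStab_le`). If the sections of H are
virtually powers of G, then a finite-index subgroup of H has finitely many jointly injective
homomorphisms to G with images of finite index, and `isVirtualPower_of_homs` splits off powers of G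
one homomorphism at a time. -/

namespace GuptaSidki

/-! ### Wreath recursion: rotations and sections -/

/-- `r` is the rotation of the first level induced by `g`, and `s` are its first-level sections. -/
def IsWreath (g : TreeAut) (r : Fin 3) (s : Fin 3 → TreeAut) : Prop :=
  g [] = [] ∧ ∀ x w, g (x :: w) = (x + r) :: s x w

theorem IsWreath.mul {g h : TreeAut} {r r' : Fin 3} {s s' : Fin 3 → TreeAut}
    (hg : IsWreath g r s) (hh : IsWreath h r' s') :
    IsWreath (g * h) (r' + r) (fun x => s (x + r') * s' x) := by
  refine ⟨?_, fun x w => ?_⟩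
  · rw [RelIso.mul_apply, hh.1, hg.1]
  · rw [RelIso.mul_apply, hh.2, hg.2, RelIso.mul_apply, add_assoc]

theorem IsWreath.inv {g : TreeAut} {r : Fin 3} {s : Fin 3 → TreeAut} (hg : IsWreath g r s) :
    IsWreath g⁻¹ (-r) (fun x => (s (x - r))⁻¹) := by
  have key : ∀ u v, g u = v → g⁻¹ v = u := by
    rintro u v rfl
    exact RelIso.inv_apply_self g u
  refine ⟨key _ _ hg.1, fun x w => key _ _ ?_⟩
  rw [hg.2, ← sub_eq_add_neg, sub_add_cancel, RelIso.apply_inv_self]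

theorem IsWreath.one : IsWreath 1 0 (fun _ => 1) :=
  ⟨rfl, fun x w => by simp⟩

theorem IsWreath.ext {g h : TreeAut} {r : Fin 3} {s : Fin 3 → TreeAut} (hg : IsWreath g r s)
    (hh : IsWreath h r s) : g = h := by
  ext1 u
  cases u with
  | nil => rw [hg.1, hh.1]
  | cons x w => rw [hg.2, hh.2]

theorem IsWreath.unique {g : TreeAut} {r r' : Fin 3} {s s' : Fin 3 → TreeAut}
    (hg : IsWreath g r s) (hg' : IsWreath g r' s') : r = r' ∧ s = s' := by
  have h : ∀ x w, (x + r) :: s x w = (x + r') :: s' x w := fun x w => by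
    rw [← hg.2, hg'.2]
  refine ⟨?_, ?_⟩
  · have := (List.cons.inj (h 0 [])).1
    simpa using this
  · funext x
    ext1 w
    exact (List.cons.inj (h x w)).2

theorem isWreath_a : IsWreath a 1 (fun _ => 1) :=
  ⟨rfl, fun _ _ => rfl⟩

theorem isWreath_b : IsWreath b 0 ![a, a⁻¹, b] := by
  refine ⟨rfl, fun x w => ?_⟩
  fin_cases x <;> rfl

theorem exists_isWreath (g : G) : ∃ r, ∃ s : Fin 3 → G, IsWreath g r (fun x => s x) := by
  obtain ⟨g, hg⟩ := g
  have ha : a ∈ G := Subgroup.subset_closure (by simp)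
  have hb : b ∈ G := Subgroup.subset_closure (by simp)
  induction hg using Subgroup.closure_induction with
  | mem x hx =>
    rcases hx with rfl | rfl
    · exact ⟨1, fun _ => 1, isWreath_a⟩
    · refine ⟨0, ![⟨a, ha⟩, ⟨a, ha⟩⁻¹, ⟨b, hb⟩], ?_⟩
      convert isWreath_b using 1
      funext x
      fin_cases x <;> rfl
  | one => exact ⟨0, fun _ => 1, IsWreath.one⟩
  | mul x y hx hy ihx ihy =>
    obtain ⟨r, s, h⟩ := ihx
    obtain ⟨r', s', h'⟩ := ihy
    exact ⟨_, fun x => s (x + r') * s' x, h.mul h'⟩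
  | inv x hx ih =>
    obtain ⟨r, s, h⟩ := ih
    exact ⟨_, fun x => (s (x - r))⁻¹, h.inv⟩

/-- The rotation of the first level induced by an element of the Gupta–Sidki group. -/
noncomputable def rho (g : G) : Fin 3 := (exists_isWreath g).choose

/-- The first-level sections of an element of the Gupta–Sidki group. -/
noncomputable def sec (g : G) : Fin 3 → G := (exists_isWreath g).choose_spec.choose

theorem isWreath (g : G) : IsWreath g (rho g) (fun x => sec g x) :=
  (exists_isWreath g).choose_spec.choose_spec

theorem coe_sec_injective {s t : Fin 3 → G}
    (h : (fun x => (s x : TreeAut)) = fun x => (t x : TreeAut)) : s = t := by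
  funext x
  exact Subtype.ext (congrFun h x)

theorem eq_of_isWreath {g : G} {r : Fin 3} {s : Fin 3 → G} (h : IsWreath g r (fun x => s x)) :
    rho g = r ∧ sec g = s := by
  obtain ⟨h1, h2⟩ := (isWreath g).unique h
  exact ⟨h1, coe_sec_injective h2⟩

theorem rho_mul (g h : G) : rho (g * h) = rho g + rho h := by
  rw [add_comm]
  exact (eq_of_isWreath (s := fun x => sec g (x + rho h) * sec h x)
    ((isWreath g).mul (isWreath h))).1

theorem sec_mul (g h : G) (x : Fin 3) : sec (g * h) x = sec g (x + rho h) * sec h x :=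
  congrFun (eq_of_isWreath (s := fun x => sec g (x + rho h) * sec h x)
    ((isWreath g).mul (isWreath h))).2 x

@[simp] theorem rho_one : rho 1 = 0 := (eq_of_isWreath (s := fun _ => 1) IsWreath.one).1

@[simp] theorem sec_one (x : Fin 3) : sec 1 x = 1 :=
  congrFun (eq_of_isWreath (s := fun _ => 1) IsWreath.one).2 x

@[simp] theorem rho_inv (g : G) : rho g⁻¹ = -rho g :=
  (eq_of_isWreath (s := fun x => (sec g (x - rho g))⁻¹) (isWreath g).inv).1

theorem sec_inv (g : G) (x : Fin 3) : sec g⁻¹ x = (sec g (x - rho g))⁻¹ :=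
  congrFun (eq_of_isWreath (s := fun x => (sec g (x - rho g))⁻¹) (isWreath g).inv).2 x

theorem ext_sec {g h : G} (h1 : rho g = rho h) (h2 : ∀ x, sec g x = sec h x) : g = h := by
  have hg := isWreath g
  rw [h1, show sec g = sec h from funext h2] at hg
  exact Subtype.ext (hg.ext (isWreath h))

/-- The generator `a`, as an element of the Gupta–Sidki group. -/
def ga : G := ⟨a, Subgroup.subset_closure (by simp)⟩

/-- The generator `b`, as an element of the Gupta–Sidki group. -/
def gb : G := ⟨b, Subgroup.subset_closure (by simp)⟩

@[simp] theorem rho_ga : rho ga = 1 := (eq_of_isWreath (g := ga) (s := fun _ => 1) isWreath_a).1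

@[simp] theorem sec_ga (x : Fin 3) : sec ga x = 1 :=
  congrFun (eq_of_isWreath (g := ga) (s := fun _ => 1) isWreath_a).2 x

theorem isWreath_gb : IsWreath gb 0 (fun x => (![ga, ga⁻¹, gb] x : G)) := by
  have h : (fun x => ((![ga, ga⁻¹, gb] x : G) : TreeAut)) = ![a, a⁻¹, b] := by
    funext x
    fin_cases x <;> rfl
  rw [h]
  exact isWreath_b

@[simp] theorem rho_gb : rho gb = 0 := (eq_of_isWreath isWreath_gb).1

theorem sec_gb (x : Fin 3) : sec gb x = ![ga, ga⁻¹, gb] x :=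
  congrFun (eq_of_isWreath isWreath_gb).2 x

@[simp] theorem sec_gb_zero : sec gb 0 = ga := sec_gb 0

@[simp] theorem sec_gb_one : sec gb 1 = ga⁻¹ := sec_gb 1

@[simp] theorem sec_gb_two : sec gb 2 = gb := sec_gb 2

theorem closure_ga_gb : Subgroup.closure {ga, gb} = (⊤ : Subgroup G) := by
  have h : Subgroup.closure ((↑) ⁻¹' {a, b}) = (⊤ : Subgroup G) :=
    Subgroup.closure_closure_coe_preimage (k := ({a, b} : Set TreeAut))
  rw [← h]
  congr 1
  ext x
  simp only [Set.mem_insert_iff, Set.mem_singleton_iff, Set.mem_preimage, ga, gb, Subtype.ext_iff]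

theorem eq_top_of_ga_gb_mem {H : Subgroup G} (ha : ga ∈ H) (hb : gb ∈ H) : H = ⊤ := by
  rw [eq_top_iff, ← closure_ga_gb, Subgroup.closure_le]
  rintro x (rfl | rfl)
  · exact ha
  · exact hb

/-- Induction on the elements of the Gupta–Sidki group. -/
theorem induction_on {P : G → Prop} (g : G) (one : P 1) (ha : P ga) (hb : P gb)
    (mul : ∀ g h, P g → P h → P (g * h)) (inv : ∀ g, P g → P g⁻¹) : P g := by
  have hg : g ∈ Subgroup.closure {ga, gb} := by rw [closure_ga_gb]; trivial
  induction hg using Subgroup.closure_induction with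
  | mem x hx => rcases hx with rfl | rfl <;> assumption
  | one => exact one
  | mul x y _ _ ihx ihy => exact mul x y ihx ihy
  | inv x _ ih => exact inv x ih

theorem ga_pow_three : ga ^ 3 = 1 := by
  apply ext_sec
  · simp only [pow_succ, pow_zero, rho_mul, rho_ga, rho_one]; rfl
  · intro x
    simp only [pow_succ, pow_zero, sec_mul, sec_ga, sec_one, mul_one]

theorem gb_pow_three : gb ^ 3 = 1 := by
  -- As b is a section of itself, comparing sections would be circular; the induction is on the
  -- word.
  have key : ∀ w : Vertex, dir 1 2 (dir 1 2 (dir 1 2 w)) = w := by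
    have hrot : ∀ (c : Fin 3) (w : Vertex), rot c (rot c (rot c w)) = w := by
      intro c w
      cases w with
      | nil => rfl
      | cons x w =>
        simp only [rot]
        congr 1
        revert x c
        decide
    intro w
    induction w with
    | nil => rfl
    | cons x w ih =>
      fin_cases x
      · simp [dir, hrot]
      · simp [dir, hrot]
      · simpa [dir] using ih
  apply Subtype.ext
  ext1 w
  exact key w

theorem sec_of_mem_zpowers_ga {s : G} (hs : s ∈ Subgroup.zpowers ga) (x : Fin 3) : sec s x = 1 := by
  have : Subgroup.zpowers ga ≤ (⟨⟨⟨{s : G | ∀ x, sec s x = 1},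
      fun {g h} hg hh x => by rw [sec_mul, hg, hh, mul_one]⟩, fun x => sec_one x⟩,
      fun {g} hg x => by rw [sec_inv, hg, inv_one]⟩ : Subgroup G) := by
    rw [Subgroup.zpowers_le]
    exact fun x => sec_ga x
  exact this hs x

/-! ### Exponents modulo 3 of elements and of their sections -/

theorem sum_shift {M : Type*} [AddCommMonoid M] (f : Fin 3 → M) (r : Fin 3) :
    f (0 + r) + f (1 + r) + f (2 + r) = f 0 + f 1 + f 2 := by
  fin_cases r
  · rfl
  · change f 1 + f 2 + f 0 = _
    abel
  · change f 2 + f 0 + f 1 = _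
    abel

/-- A rotation only permutes the three summands, so the sum is a homomorphism; it vanishes on a, and
on b = (a, a⁻¹, b). -/
theorem sum_rho_sec (g : G) : rho (sec g 0) + rho (sec g 1) + rho (sec g 2) = 0 := by
  have hmul : ∀ g h : G, rho (sec (g * h) 0) + rho (sec (g * h) 1) + rho (sec (g * h) 2) =
      (rho (sec g 0) + rho (sec g 1) + rho (sec g 2)) +
      (rho (sec h 0) + rho (sec h 1) + rho (sec h 2)) := by
    intro g h
    rw [← sum_shift (fun x => rho (sec g x)) (rho h)]
    simp only [sec_mul, rho_mul]
    abel
  induction g using induction_on with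
  | one => simp
  | ha => simp
  | hb => simp
  | mul g h hg hh => rw [hmul, hg, hh, add_zero]
  | inv g hg =>
    have := hmul g g⁻¹
    rw [hg, zero_add, mul_inv_cancel] at this
    rw [← this]
    simp

/-- The exponent of `b` modulo `3` in an element of the Gupta–Sidki group. -/
noncomputable def beta (g : G) : Fin 3 := rho (sec g 2) - rho (sec g 1)

/-- Three elements of ℤ/3 with sum zero form a cyclic arithmetic progression. Its common difference
is insensitive to rotation, which is why `beta` is additive. -/
theorem rho_sec_add_one_sub (g : G) (x : Fin 3) :
    rho (sec g (x + 1)) - rho (sec g x) = beta g := by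
  have h := sum_rho_sec g
  have key : ∀ s t u : Fin 3, s + t + u = 0 → t - s = u - t ∧ s - u = u - t := by decide
  obtain ⟨h1, h2⟩ := key _ _ _ h
  fin_cases x
  · exact h1
  · rfl
  · exact h2

theorem beta_mul (g h : G) : beta (g * h) = beta g + beta h := by
  rw [← rho_sec_add_one_sub g (1 + rho h), beta, beta, sec_mul, sec_mul, rho_mul, rho_mul,
    show (1 + rho h + 1 : Fin 3) = 2 + rho h by rw [add_right_comm]; rfl]
  abel

@[simp] theorem beta_one : beta 1 = 0 := by simp [beta]

@[simp] theorem beta_ga : beta ga = 0 := by simp [beta]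

@[simp] theorem beta_gb : beta gb = 1 := by simp [beta]

@[simp] theorem beta_inv (g : G) : beta g⁻¹ = -beta g := by
  have h := beta_mul g g⁻¹
  rw [mul_inv_cancel, beta_one] at h
  exact (neg_eq_of_add_eq_zero_right h.symm).symm

theorem sum_beta_sec (g : G) : beta (sec g 0) + beta (sec g 1) + beta (sec g 2) = beta g := by
  induction g using induction_on with
  | one => simp
  | ha => simp
  | hb => simp
  | mul g h hg hh =>
    rw [beta_mul, ← hg, ← hh, ← sum_shift (fun x => beta (sec g x)) (rho h)]
    simp only [sec_mul, beta_mul]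
    abel
  | inv g hg =>
    rw [beta_inv, ← hg, ← sum_shift (fun x => beta (sec g x)) (-rho g)]
    simp only [sec_inv, beta_inv, sub_eq_add_neg]
    abel

/-- Both sides obey the same product rule and agree on generators. Consequently, if no section
involves b modulo 3, all sections fix the first level. -/
theorem rho_sec_eq (g : G) (x : Fin 3) :
    rho (sec g x) = beta (sec g (x + 2)) - beta (sec g (x + 1)) := by
  induction g using induction_on generalizing x with
  | one => simp
  | ha => simp
  | hb => fin_cases x <;> simp [sec_gb]
  | mul g h hg hh =>
    simp only [sec_mul, rho_mul, beta_mul]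
    rw [hg, hh, add_right_comm x 2, add_right_comm x 1]
    abel
  | inv g hg =>
    simp only [sec_inv, rho_inv, beta_inv]
    rw [hg, ← sub_add_eq_add_sub, ← sub_add_eq_add_sub]
    abel

theorem sec_conj (s g : G) (x : Fin 3) (hg : rho g = 0) :
    sec (s * g * s⁻¹) (x + rho s) = sec s x * sec g x * (sec s x)⁻¹ := by
  rw [sec_mul, sec_mul, sec_inv, rho_inv, add_neg_cancel_right, hg, add_zero,
    add_sub_cancel_right]

theorem rho_of_mem_zpowers_gb {s : G} (hs : s ∈ Subgroup.zpowers gb) : rho s = 0 := by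
  obtain ⟨k, rfl⟩ := hs
  induction k with
  | zero => simp
  | succ n ih => simpa [zpow_add_one, rho_mul] using ih
  | pred n ih => simpa [zpow_sub_one, rho_mul] using ih

theorem sec_two_of_mem_zpowers_gb {s : G} (hs : s ∈ Subgroup.zpowers gb) :
    sec s 2 ∈ Subgroup.zpowers gb := by
  obtain ⟨k, rfl⟩ := hs
  induction k with
  | zero => simp
  | succ n ih =>
    simp only at ih ⊢
    rw [zpow_add_one, sec_mul, rho_gb, add_zero, sec_gb_two]
    exact mul_mem ih (Subgroup.mem_zpowers _)
  | pred n ih =>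
    simp only at ih ⊢
    rw [zpow_sub_one, sec_mul, rho_inv, rho_gb, neg_zero, add_zero, sec_inv, rho_gb, sub_zero,
      sec_gb_two]
    exact mul_mem ih (inv_mem (Subgroup.mem_zpowers _))

theorem sec_mem_zpowers_ga_of_mem_zpowers_gb {s : G} (hs : s ∈ Subgroup.zpowers gb) {x : Fin 3}
    (hx : x ≠ 2) : sec s x ∈ Subgroup.zpowers ga := by
  have h : sec gb x ∈ Subgroup.zpowers ga := by
    fin_cases x
    · simp
    · simp
    · exact absurd rfl hx
  obtain ⟨k, rfl⟩ := hs
  induction k with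
  | zero => simp
  | succ n ih =>
    simp only at ih ⊢
    rw [zpow_add_one, sec_mul, rho_gb, add_zero]
    exact mul_mem ih h
  | pred n ih =>
    simp only at ih ⊢
    rw [zpow_sub_one, sec_mul, rho_inv, rho_gb, neg_zero, add_zero, sec_inv, rho_gb, sub_zero]
    exact mul_mem ih (inv_mem h)

/-! ### Section subgroups and labelled graphs -/

/-- The section at the vertex `x` of the stabilizer of the first level in `H`. -/
def sectionSubgroup (H : Subgroup G) (x : Fin 3) : Subgroup G where
  carrier := {h | ∃ g ∈ H, rho g = 0 ∧ sec g x = h}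
  one_mem' := ⟨1, one_mem H, rho_one, sec_one x⟩
  mul_mem' := by
    rintro _ _ ⟨g, hg, hr, rfl⟩ ⟨h, hh, hr', rfl⟩
    exact ⟨g * h, mul_mem hg hh, by rw [rho_mul, hr, hr', add_zero],
      by rw [sec_mul, hr', add_zero]⟩
  inv_mem' := by
    rintro _ ⟨g, hg, hr, rfl⟩
    exact ⟨g⁻¹, inv_mem hg, by rw [rho_inv, hr, neg_zero], by rw [sec_inv, hr, sub_zero]⟩

/-- A graph with edges labelled by powers of `a` and by `b` and `b⁻¹`, the edges labelled by
`b` or `b⁻¹` being supported on a finite set. -/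
structure LabelledGraph (ι : Type) where
  edge : ι → G → ι → Prop
  paid : Finset (ι × ι)
  symm : ∀ {i s j}, edge i s j → edge j s⁻¹ i
  label : ∀ {i s j}, edge i s j → s ∈ Subgroup.zpowers ga ∨ (s = gb ∧ (i, j) ∈ paid) ∨
    (s = gb⁻¹ ∧ (j, i) ∈ paid)

namespace LabelledGraph

variable {ι : Type}

/-- Walks, with the product of their labels and the number of edges labelled by `b` or `b⁻¹`. -/
inductive Walk (E : LabelledGraph ι) : ι → G → ℕ → ι → Prop
  | nil (i : ι) : Walk E i 1 0 i
  | free {i j k : ι} {g s : G} {n : ℕ} : Walk E i g n j → E.edge j s k →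
      s ∈ Subgroup.zpowers ga → Walk E i (s * g) n k
  | paid {i j k : ι} {g s : G} {n : ℕ} : Walk E i g n j → E.edge j s k →
      s ∈ Subgroup.zpowers gb → Walk E i (s * g) (n + 1) k

variable {E : LabelledGraph ι} {i j k : ι} {g h s : G} {m n : ℕ}

theorem Walk.trans (hg : E.Walk i g m j) (hh : E.Walk j h n k) : E.Walk i (h * g) (m + n) k := by
  induction hh with
  | nil => simpa using hg
  | free _ he hs ih => rw [mul_assoc]; exact ih.free he hs
  | paid _ he hs ih => rw [mul_assoc]; exact ih.paid he hs

theorem Walk.symm (hg : E.Walk i g n j) : E.Walk j g⁻¹ n i := by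
  induction hg with
  | nil => rw [inv_one]; exact Walk.nil _
  | free _ he hs ih =>
    have h1 := ((Walk.nil _).free (E.symm he) (inv_mem hs)).trans ih
    simpa using h1
  | paid _ he hs ih =>
    have h1 := ((Walk.nil _).paid (E.symm he) (inv_mem hs)).trans ih
    simpa [add_comm] using h1

theorem exists_walk_of_edge (he : E.edge i s j) : ∃ n, E.Walk i s n j := by
  rcases E.label he with h | ⟨rfl, -⟩ | ⟨rfl, -⟩
  · exact ⟨_, by simpa using (Walk.nil _).free he h⟩
  · exact ⟨_, by simpa using (Walk.nil _).paid he (Subgroup.mem_zpowers _)⟩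
  · exact ⟨_, by simpa using (Walk.nil _).paid he (inv_mem (Subgroup.mem_zpowers _))⟩

theorem Walk.mem_zpowers_of_eq_zero (hg : E.Walk i g n j) (hn : n = 0) :
    g ∈ Subgroup.zpowers ga := by
  induction hg with
  | nil => exact one_mem _
  | free _ he hs ih => exact mul_mem hs (ih hn)
  | paid => omega

variable (E) in
/-- The group of labels of closed walks at a vertex. -/
def loops (i : ι) : Subgroup G where
  carrier := {g | ∃ n, E.Walk i g n i}
  one_mem' := ⟨0, Walk.nil i⟩
  mul_mem' := fun ⟨_, hg⟩ ⟨_, hh⟩ => ⟨_, hh.trans hg⟩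
  inv_mem' := fun ⟨_, hg⟩ => ⟨_, hg.symm⟩

theorem Walk.conj_mem_loops (hw : E.Walk i g n j) (hh : h ∈ E.loops j) :
    g⁻¹ * h * g ∈ E.loops i := by
  obtain ⟨m, hh⟩ := hh
  exact ⟨_, by rw [mul_assoc]; exact (hw.trans hh).trans hw.symm⟩

theorem Walk.map_conj_loops (hw : E.Walk i g n j) :
    (E.loops i).map (MulAut.conj g).toMonoidHom = E.loops j := by
  ext h
  simp only [Subgroup.mem_map, MulEquiv.coe_toMonoidHom, MulAut.conj_apply]
  constructor
  · rintro ⟨h, hh, rfl⟩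
    simpa using hw.symm.conj_mem_loops hh
  · exact fun hh => ⟨_, hw.conj_mem_loops hh, by group⟩

variable (E) in
/-- The graph of sections: vertices are replaced by the first level of the tree over them. -/
def sectionGraph : LabelledGraph (ι × Fin 3) where
  edge p s q := ∃ t, E.edge p.1 t q.1 ∧ q.2 = p.2 + rho t ∧ s = sec t p.2
  paid := E.paid.map ⟨fun e => ((e.1, 2), (e.2, 2)), fun e f h => by
    simp only [Prod.mk.injEq] at h
    exact Prod.ext h.1.1 h.2.1⟩
  symm := by
    rintro p s q ⟨t, he, hq, rfl⟩
    refine ⟨t⁻¹, E.symm he, by rw [hq, rho_inv, add_neg_cancel_right], ?_⟩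
    rw [hq, sec_inv, add_sub_cancel_right]
  label := by
    rintro ⟨i, x⟩ s ⟨j, y⟩ ⟨t, he, hq, rfl⟩
    simp only at he hq
    rcases E.label he with h | ⟨rfl, h⟩ | ⟨rfl, h⟩
    · exact Or.inl (by rw [sec_of_mem_zpowers_ga h]; exact one_mem _)
    · rw [rho_gb, add_zero] at hq
      subst hq
      fin_cases y
      · exact Or.inl (by simp)
      · exact Or.inl (by simp)
      · exact Or.inr (Or.inl ⟨sec_gb_two, Finset.mem_map.2 ⟨_, h, rfl⟩⟩)
    · rw [rho_inv, rho_gb, neg_zero, add_zero] at hq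
      subst hq
      fin_cases y
      · exact Or.inl (by simp [sec_inv])
      · exact Or.inl (by simp [sec_inv])
      · exact Or.inr (Or.inr ⟨by simp [sec_inv], Finset.mem_map.2 ⟨_, h, rfl⟩⟩)

theorem card_paid_sectionGraph : E.sectionGraph.paid.card = E.paid.card := Finset.card_map _

/-- The three lifts of a walk share its edges labelled by `b` or `b⁻¹`. -/
theorem Walk.exists_lift (hg : E.Walk i g n j) : ∃ m : Fin 3 → ℕ, m 0 + m 1 + m 2 = n ∧
    ∀ x, E.sectionGraph.Walk (i, x) (sec g x) (m x) (j, x + rho g) ∧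
      (m x = n → sec g x ∈ Subgroup.zpowers gb) := by
  induction hg with
  | nil =>
    refine ⟨fun _ => 0, rfl, fun x => ⟨?_, fun _ => ?_⟩⟩
    · rw [sec_one, rho_one, add_zero]
      exact Walk.nil _
    · rw [sec_one]
      exact one_mem _
  | @free j k g s n _ he hs ih =>
    obtain ⟨m, hm, ih⟩ := ih
    refine ⟨m, hm, fun x => ⟨?_, fun h => ?_⟩⟩
    · rw [sec_mul]
      refine (ih x).1.free ⟨s, he, ?_, rfl⟩ ?_
      · rw [rho_mul, add_assoc, add_comm (rho s)]
      · rw [sec_of_mem_zpowers_ga hs]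
        exact one_mem _
    · rw [sec_mul, sec_of_mem_zpowers_ga hs, one_mul]
      exact (ih x).2 h
  | @paid j k g s n _ he hs ih =>
    obtain ⟨m, hm, ih⟩ := ih
    have hr : rho s = 0 := rho_of_mem_zpowers_gb hs
    -- As s is a power of b, the one lift standing at the letter 2 picks up a power of b and pays
    -- for it; the other two pick up powers of a for free. So a lift that has paid for every b-edge
    -- has only met powers of b, apart from the trivial sections of powers of a.
    refine ⟨fun x => m x + if x + rho g = 2 then 1 else 0, ?_, fun x => ?_⟩
    · have : ∀ r : Fin 3, (if 0 + r = 2 then 1 else 0) + (if 1 + r = 2 then 1 else 0) +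
        (if 2 + r = 2 then 1 else 0) = 1 := by decide
      have := this (rho g)
      beta_reduce
      omega
    · have hle : m x ≤ n := by
        have : m x = m 0 ∨ m x = m 1 ∨ m x = m 2 := by fin_cases x <;> simp
        omega
      have hedge : E.sectionGraph.edge (j, x + rho g) (sec s (x + rho g)) (k, x + rho (s * g)) :=
        ⟨s, he, by rw [rho_mul, hr, zero_add, add_zero], rfl⟩
      rw [sec_mul]
      by_cases hx : x + rho g = 2
      · simp only [hx, if_true] at hedge ⊢
        have h2 := sec_two_of_mem_zpowers_gb hs
        refine ⟨Walk.paid (hx ▸ (ih x).1) hedge h2, fun h => mul_mem h2 ((ih x).2 (by omega))⟩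
      · simp only [hx, if_false]
        exact ⟨(ih x).1.free hedge (sec_mem_zpowers_ga_of_mem_zpowers_gb hs hx),
          fun h => by omega⟩

theorem Walk.exists_proj {p q : ι × Fin 3} (hh : E.sectionGraph.Walk p h n q) :
    ∃ g m, E.Walk p.1 g m q.1 ∧ q.2 = p.2 + rho g ∧ h = sec g p.2 := by
  have key : ∀ {p q r : ι × Fin 3} {s h : G}, (∃ g m, E.Walk p.1 g m q.1 ∧ q.2 = p.2 + rho g ∧
      h = sec g p.2) → E.sectionGraph.edge q s r →
      ∃ g m, E.Walk p.1 g m r.1 ∧ r.2 = p.2 + rho g ∧ s * h = sec g p.2 := by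
    rintro p q r s h ⟨g, m, hw, hq, rfl⟩ ⟨t, he, hr, rfl⟩
    obtain ⟨n, ht⟩ := exists_walk_of_edge he
    refine ⟨_, _, hw.trans ht, ?_, ?_⟩
    · rw [hr, hq, rho_mul, add_assoc, add_comm (rho t)]
    · rw [sec_mul, hq]
  induction hh with
  | nil => exact ⟨1, 0, Walk.nil _, by simp, by simp⟩
  | free _ he _ ih => exact key ih he
  | paid _ he _ ih => exact key ih he

theorem sectionSubgroup_loops (x : Fin 3) :
    sectionSubgroup (E.loops i) x = E.sectionGraph.loops (i, x) := by
  ext h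
  constructor
  · rintro ⟨g, ⟨n, hg⟩, hr, rfl⟩
    obtain ⟨m, -, hm⟩ := hg.exists_lift
    have := (hm x).1
    rw [hr, add_zero] at this
    exact ⟨_, this⟩
  · rintro ⟨n, hh⟩
    obtain ⟨g, m, hg, hr, rfl⟩ := hh.exists_proj
    exact ⟨g, ⟨m, hg⟩, by simpa using hr, rfl⟩

variable (E) in
/-- Adjoin closed edges labelled by all the powers of `a` at a vertex. -/
def addLoop (p : ι) : LabelledGraph ι where
  edge i s j := E.edge i s j ∨ (i = p ∧ j = p ∧ s ∈ Subgroup.zpowers ga)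
  paid := E.paid
  symm := by
    rintro i s j (h | ⟨rfl, rfl, h⟩)
    · exact Or.inl (E.symm h)
    · exact Or.inr ⟨rfl, rfl, inv_mem h⟩
  label := by
    rintro i s j (h | ⟨rfl, rfl, h⟩)
    · exact E.label h
    · exact Or.inl h

theorem Walk.addLoop (hg : E.Walk i g n j) (p : ι) : (E.addLoop p).Walk i g n j := by
  induction hg with
  | nil => exact Walk.nil _
  | free _ he hs ih => exact ih.free (Or.inl he) hs
  | paid _ he hs ih => exact ih.paid (Or.inl he) hs

/-- Once a labels a closed walk at p, its powers may be used there at no cost without changing any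
loop group. -/
theorem loops_addLoop {p : ι} (hp : ga ∈ E.loops p) : (E.addLoop p).loops i = E.loops i := by
  have key : ∀ {q r : ι} {s : G}, (E.addLoop p).edge q s r → ∃ n, E.Walk q s n r := by
    rintro q r s (h | ⟨rfl, rfl, h⟩)
    · exact exists_walk_of_edge h
    · exact (Subgroup.zpowers_le.2 hp) h
  have walk : ∀ {g n j}, (E.addLoop p).Walk i g n j → ∃ m, E.Walk i g m j := by
    intro g n j hg
    induction hg with
    | nil => exact ⟨_, Walk.nil _⟩
    | free _ he hs ih =>
      obtain ⟨m, hm⟩ := key he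
      obtain ⟨n, hn⟩ := ih
      exact ⟨_, hn.trans hm⟩
    | paid _ he hs ih =>
      obtain ⟨m, hm⟩ := key he
      obtain ⟨n, hn⟩ := ih
      exact ⟨_, hn.trans hm⟩
  exact le_antisymm (fun g ⟨n, hg⟩ => walk hg) fun g ⟨n, hg⟩ => ⟨n, hg.addLoop p⟩

variable (E) in
/-- Reachability by walks. -/
def Reach (i j : ι) : Prop := ∃ g n, E.Walk i g n j

theorem Reach.edge (hi : E.Reach i j) (he : E.edge j s k) : E.Reach i k := by
  obtain ⟨g, n, hg⟩ := hi
  obtain ⟨m, hm⟩ := exists_walk_of_edge he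
  exact ⟨_, _, hg.trans hm⟩

variable (E) in
open Classical in
/-- The connected component of a vertex. -/
noncomputable def component (r : ι) : LabelledGraph ι where
  edge i s j := E.edge i s j ∧ E.Reach r i
  paid := E.paid.filter fun e => E.Reach r e.1
  symm := fun ⟨h, hr⟩ => ⟨E.symm h, hr.edge h⟩
  label := by
    rintro i s j ⟨h, hr⟩
    rcases E.label h with h' | ⟨rfl, h'⟩ | ⟨rfl, h'⟩
    · exact Or.inl h'
    · exact Or.inr (Or.inl ⟨rfl, Finset.mem_filter.2 ⟨h', hr⟩⟩)
    · exact Or.inr (Or.inr ⟨rfl, Finset.mem_filter.2 ⟨h', hr.edge h⟩⟩)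

theorem walk_component_iff : (E.component i).Walk i g n j ↔ E.Walk i g n j := by
  refine ⟨fun hg => ?_, fun hg => ?_⟩
  · induction hg with
    | nil => exact Walk.nil _
    | free _ he hs ih => exact ih.free he.1 hs
    | paid _ he hs ih => exact ih.paid he.1 hs
  · induction hg with
    | nil => exact Walk.nil _
    | free hw he hs ih => exact ih.free ⟨he, _, _, hw⟩ hs
    | paid hw he hs ih => exact ih.paid ⟨he, _, _, hw⟩ hs

theorem loops_component : (E.component i).loops i = E.loops i := by
  ext g
  exact exists_congr fun n => walk_component_iff

end LabelledGraph

/-! ### Inductive classes contain all finitely generated subgroups -/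

/-- A class of subgroups which contains the finite subgroups and the whole group, is closed under
conjugation, and contains a subgroup as soon as it contains its first-level sections. -/
structure IsInductive (X : Subgroup G → Prop) : Prop where
  finite : ∀ H : Subgroup G, Finite H → X H
  top : X ⊤
  conj : ∀ (H : Subgroup G) (g : G), X H → X (H.map (MulAut.conj g).toMonoidHom)
  of_section : ∀ H : Subgroup G, (∀ x, X (sectionSubgroup H x)) → X H

namespace LabelledGraph

variable {ι : Type} {E : LabelledGraph ι} {i j k : ι} {g h s : G} {m n N : ℕ}
  {X : Subgroup G → Prop}

theorem finite_of_le_zpowers {H : Subgroup G} {c : G} (hc : c ^ 3 = 1)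
    (hH : H ≤ Subgroup.zpowers c) : Finite H := by
  have : Finite (Subgroup.zpowers c) :=
    (isOfFinOrder_iff_pow_eq_one.2 ⟨3, by norm_num, hc⟩).finite_zpowers
  exact Finite.of_injective _ (Subgroup.inclusion_injective hH)

theorem mem_of_reach (hX : IsInductive X) (hr : E.Reach i j) (hi : X (E.loops i)) :
    X (E.loops j) := by
  obtain ⟨g, n, hg⟩ := hr
  rw [← hg.map_conj_loops]
  exact hX.conj _ _ hi

/-- The induction hypothesis on the number of edges labelled by `b` or `b⁻¹`. -/
def HoldsBelow (X : Subgroup G → Prop) (N : ℕ) : Prop :=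
  ∀ {ι : Type} (E : LabelledGraph ι) (i : ι), E.paid.card < N → X (E.loops i)

/-- If a component of the section graph misses a b-edge, the induction hypothesis applies to it.
Otherwise it contains the endpoints (·, 2) of all b-edges; since closed walks at i do not rotate, it
meets each fibre at most once, so every b-edge is traversed at the letter 2 and all labels are
powers of b. The section is then finite. -/
theorem mem_of_stabilizing (hX : IsInductive X) (hN : HoldsBelow X N) (hE : E.paid.card ≤ N)
    (hst : ∀ g ∈ E.loops i, rho g = 0) : X (E.loops i) := by
  classical
  refine hX.of_section _ fun x => ?_
  rw [sectionSubgroup_loops]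
  by_cases hlt : (E.sectionGraph.component (i, x)).paid.card < N
  · rw [← loops_component]
    exact hN _ _ hlt
  have heq : (E.sectionGraph.component (i, x)).paid = E.sectionGraph.paid := by
    refine Finset.eq_of_subset_of_card_le (Finset.filter_subset _ _) ?_
    rw [card_paid_sectionGraph]
    omega
  have hreach : ∀ e ∈ E.paid, E.sectionGraph.Reach (i, x) (e.1, 2) := by
    intro e he
    have h1 : ((e.1, 2), (e.2, 2)) ∈ (E.sectionGraph.component (i, x)).paid := by
      rw [heq]
      exact Finset.mem_map.2 ⟨e, he, rfl⟩
    exact (Finset.mem_filter.1 h1).2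
  have hunique : ∀ {p : ι} {y z : Fin 3}, E.sectionGraph.Reach (i, x) (p, y) →
      E.sectionGraph.Reach (i, x) (p, z) → y = z := by
    rintro p y z ⟨_, _, h1⟩ ⟨_, _, h2⟩
    obtain ⟨g1, _, h1, e1, -⟩ := h1.exists_proj
    obtain ⟨g2, _, h2, e2, -⟩ := h2.exists_proj
    have := hst _ ⟨_, h1.trans h2.symm⟩
    rw [rho_mul, rho_inv, neg_add_eq_zero] at this
    simp only at e1 e2
    rw [e1, e2, this]
  have hedge : ∀ {q r : ι × Fin 3} {s : G}, E.sectionGraph.Reach (i, x) q →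
      E.sectionGraph.edge q s r → s ∈ Subgroup.zpowers gb := by
    rintro ⟨q, y⟩ ⟨r, z⟩ s hq ⟨t, he, hz, rfl⟩
    simp only at he hz ⊢
    rcases E.label he with h | ⟨rfl, h⟩ | ⟨rfl, h⟩
    · rw [sec_of_mem_zpowers_ga h]
      exact one_mem _
    · rw [hunique hq (hreach _ h)]
      exact sec_two_of_mem_zpowers_gb (Subgroup.mem_zpowers _)
    · have hr : E.sectionGraph.Reach (i, x) (q, 2) := by
        refine (hreach _ h).edge (s := sec gb 2) ⟨gb, ?_, ?_, rfl⟩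
        · simpa using E.symm he
        · simp
      rw [hunique hq hr]
      exact sec_two_of_mem_zpowers_gb (inv_mem (Subgroup.mem_zpowers _))
  have hwalk : ∀ {h n q}, E.sectionGraph.Walk (i, x) h n q → h ∈ Subgroup.zpowers gb := by
    intro h n q hw
    induction hw with
    | nil => exact one_mem _
    | free hw he _ ih => exact mul_mem (hedge ⟨_, _, hw⟩ he) ih
    | paid hw he _ ih => exact mul_mem (hedge ⟨_, _, hw⟩ he) ih
  exact hX.finite _ (finite_of_le_zpowers gb_pow_three fun h ⟨n, hw⟩ => hwalk hw)

theorem reach_sectionGraph {x : Fin 3} (hg : g ∈ E.loops i) (hr : rho g ≠ 0) (y : Fin 3) :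
    E.sectionGraph.Reach (i, x) (i, y) := by
  have key : ∀ {g : G}, g ∈ E.loops i → ∀ x, E.sectionGraph.Reach (i, x) (i, x + rho g) := by
    rintro g ⟨n, hg⟩ x
    obtain ⟨m, -, hm⟩ := hg.exists_lift
    exact ⟨_, _, (hm x).1⟩
  have hcases : ∀ r x y : Fin 3, r ≠ 0 → y = x + 0 ∨ y = x + r ∨ y = x + (r + r) := by decide
  rcases hcases (rho g) x y hr with h | h | h <;> rw [h]
  · simpa using key (one_mem _) x
  · exact key hg x
  · rw [← rho_mul]
    exact key (mul_mem hg hg) x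

/-- One section suffices: either nothing rotates the first level and `mem_of_stabilizing` applies,
or the three vertices over i are connected and the three sections are conjugate. -/
theorem mem_of_mem_sectionGraph (hX : IsInductive X) (hN : HoldsBelow X N) (hE : E.paid.card ≤ N)
    {x : Fin 3} (hx : X (E.sectionGraph.loops (i, x))) : X (E.loops i) := by
  by_cases hst : ∀ g ∈ E.loops i, rho g = 0
  · exact mem_of_stabilizing hX hN hE hst
  push Not at hst
  obtain ⟨g, hg, hr⟩ := hst
  refine hX.of_section _ fun y => ?_
  rw [sectionSubgroup_loops]
  exact mem_of_reach hX (reach_sectionGraph hg hr y) hx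

theorem exists_mem_zpowers_ga (x y : Fin 3) : ∃ s ∈ Subgroup.zpowers ga, y = x + rho s := by
  have hcases : ∀ x y : Fin 3, y = x + 0 ∨ y = x + 1 ∨ y = x + -1 := by decide
  rcases hcases x y with h | h | h
  · exact ⟨1, one_mem _, by rw [h, rho_one]⟩
  · exact ⟨ga, Subgroup.mem_zpowers _, by rw [h, rho_ga]⟩
  · exact ⟨ga⁻¹, inv_mem (Subgroup.mem_zpowers _), by rw [h, rho_inv, rho_ga]⟩

theorem mem_loops_of_walk_zpowers {c : G} (hw : E.Walk i g n j) (hg : g ∈ Subgroup.zpowers c)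
    (hc : c ∈ E.loops j) : c ∈ E.loops i := by
  have h := hw.conj_mem_loops hc
  obtain ⟨k, rfl⟩ := hg
  have : (c ^ k)⁻¹ * c * c ^ k = c := by group
  rwa [this] at h

/-- If `a` and `b` label closed walks at vertices at bounded distance, the distance can be
decreased by passing to sections. -/
theorem mem_of_loops_ga_gb (hX : IsInductive X) (hN : HoldsBelow X N) (d : ℕ) :
    ∀ {ι : Type} (E : LabelledGraph ι) (p q : ι) (w : G), E.paid.card ≤ N →
      gb ∈ E.loops q → (∀ s ∈ Subgroup.zpowers ga, E.edge p s p) → E.Walk p w d q →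
      X (E.loops q) := by
  induction d using Nat.strong_induction_on with
  | _ d ih =>
  intro ι E p q w hE hb ha hw
  obtain ⟨m, hm, hlift⟩ := hw.exists_lift
  -- Powers of a have trivial sections, so the free loops at p connect the fibre over p by edges
  -- labelled 1.
  have hflat : ∀ x y, E.sectionGraph.Walk (p, x) 1 0 (p, y) := by
    intro x y
    obtain ⟨s, hs, rfl⟩ := exists_mem_zpowers_ga x y
    have he : E.sectionGraph.edge (p, x) 1 (p, x + rho s) :=
      ⟨s, ha s hs, rfl, (sec_of_mem_zpowers_ga hs x).symm⟩
    simpa using (Walk.nil _).free he (one_mem _)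
  have hend : ∀ c, E.sectionGraph.Walk (p, c - rho w) (sec w (c - rho w)) (m (c - rho w)) (q, c) := by
    intro c
    simpa using (hlift (c - rho w)).1
  have hbsec : ∀ c, sec gb c ∈ E.sectionGraph.loops (q, c) := by
    intro c
    rw [← sectionSubgroup_loops]
    exact ⟨gb, hb, rho_gb, rfl⟩
  have ha0 : ga ∈ E.sectionGraph.loops (q, 0) := by simpa using hbsec 0
  have ha1 : ga ∈ E.sectionGraph.loops (q, 1) := by simpa using hbsec 1
  have hb2 : gb ∈ E.sectionGraph.loops (q, 2) := by simpa using hbsec 2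
  have hsum := sum_shift m (-rho w)
  simp only [← sub_eq_add_neg] at hsum
  -- For c = 0, 1 the loop b at q has section a or a⁻¹ at (q, c), and b at (q, 2). The lifted walks
  -- join these vertices through the fibre over p at the cost of two of the three lifts.
  have short : ∀ c, ga ∈ E.sectionGraph.loops (q, c) → m (c - rho w) + m (2 - rho w) < d →
      X (E.loops q) := by
    intro c hc hlt
    refine mem_of_mem_sectionGraph hX hN hE (x := 2) ?_
    rw [← loops_addLoop hc]
    have hwalk := ((hend c).symm.trans (hflat _ (2 - rho w))).trans (hend 2)
    rw [add_zero] at hwalk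
    refine ih _ hlt (E.sectionGraph.addLoop (q, c)) (q, c) (q, 2) _
      (card_paid_sectionGraph.trans_le hE) (by rwa [loops_addLoop hc])
      (fun s hs => Or.inr ⟨rfl, rfl, hs⟩) (hwalk.addLoop (q, c))
  by_cases h0 : m (0 - rho w) + m (2 - rho w) < d
  · exact short 0 ha0 h0
  by_cases h1 : m (1 - rho w) + m (2 - rho w) < d
  · exact short 1 ha1 h1
  -- Now the lift ending at (q, 2) carries the whole cost d, so its label is a power of b, which
  -- commutes with b; the lift ending at (q, 0) is free, so its label is a power of a. Hence a and b
  -- both label closed walks at one vertex over p.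
  refine mem_of_mem_sectionGraph hX hN hE (x := 2) ?_
  refine mem_of_reach hX (i := (p, 2 - rho w)) ⟨_, _, hend 2⟩ ?_
  have hga : ga ∈ E.sectionGraph.loops (p, 2 - rho w) := by
    have hz : m (0 - rho w) = 0 := by omega
    have hw0 := hend 0
    refine mem_loops_of_walk_zpowers (hflat _ (0 - rho w)) (one_mem _) ?_
    exact mem_loops_of_walk_zpowers hw0 (hw0.mem_zpowers_of_eq_zero hz) ha0
  have hgb : gb ∈ E.sectionGraph.loops (p, 2 - rho w) :=
    mem_loops_of_walk_zpowers (hend 2) ((hlift (2 - rho w)).2 (by omega)) hb2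
  rw [eq_top_of_ga_gb_mem hga hgb]
  exact hX.top

/-- If some closed walk rotates the first level, then (i, 0), with loop a, is connected to (i, 2),
with loop b, which is the situation of `mem_of_loops_ga_gb`. -/
theorem mem_of_gb_mem_loops (hX : IsInductive X) (hN : HoldsBelow X N) (hE : E.paid.card ≤ N)
    (hb : gb ∈ E.loops i) : X (E.loops i) := by
  by_cases hst : ∀ g ∈ E.loops i, rho g = 0
  · exact mem_of_stabilizing hX hN hE hst
  push Not at hst
  obtain ⟨g, hg, hr⟩ := hst
  have hbsec : ∀ c, sec gb c ∈ E.sectionGraph.loops (i, c) := by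
    intro c
    rw [← sectionSubgroup_loops]
    exact ⟨gb, hb, rho_gb, rfl⟩
  have ha0 : ga ∈ E.sectionGraph.loops (i, 0) := by simpa using hbsec 0
  have hb2 : gb ∈ E.sectionGraph.loops (i, 2) := by simpa using hbsec 2
  obtain ⟨w, d, hw⟩ := reach_sectionGraph (x := 0) hg hr 2
  refine mem_of_mem_sectionGraph hX hN hE (x := 2) ?_
  rw [← loops_addLoop ha0]
  exact mem_of_loops_ga_gb hX hN d (E.sectionGraph.addLoop (i, 0)) (i, 0) (i, 2) w
    (card_paid_sectionGraph.trans_le hE) (by rwa [loops_addLoop ha0])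
    (fun s hs => Or.inr ⟨rfl, rfl, hs⟩) (hw.addLoop _)

theorem gb_mem_of_zpowers {H : Subgroup G} (hg : g ∈ Subgroup.zpowers gb) (hβ : beta g ≠ 0)
    (hH : g ∈ H) : gb ∈ H := by
  obtain ⟨k, rfl⟩ := hg
  simp only at hβ hH
  have h3 : gb ^ (3 : ℤ) = 1 := by exact_mod_cast gb_pow_three
  have hk : gb ^ k = gb ^ (k % 3) := by
    conv_lhs => rw [← Int.emod_add_mul_ediv k 3, zpow_add, zpow_mul, h3, one_zpow, mul_one]
  rw [hk] at hβ hH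
  have : k % 3 = 0 ∨ k % 3 = 1 ∨ k % 3 = 2 := by omega
  rcases this with h | h | h <;> rw [h] at hβ hH
  · simp at hβ
  · simpa using hH
  · have : gb = (gb ^ (2 : ℤ))⁻¹ := by
      rw [eq_inv_iff_mul_eq_one, ← zpow_one_add]
      exact h3
    rw [this]
    exact inv_mem hH

/-- Closed walks whose label has a nonzero exponent of `b` can be shortened by passing to
sections. -/
theorem mem_of_beta_ne_zero (hX : IsInductive X) (hN : HoldsBelow X N) (n : ℕ) :
    ∀ {ι : Type} (E : LabelledGraph ι) (i : ι) (g : G), E.paid.card ≤ N → E.Walk i g n i →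
      beta g ≠ 0 → X (E.loops i) := by
  induction n using Nat.strong_induction_on with
  | _ n ih =>
  -- The exponents of b in the sections add up to that of g, so one of them is nonzero. Either its
  -- walk is shorter, or it pays for everything and its label is a nontrivial power of b.
  have stab : ∀ {ι : Type} (E : LabelledGraph ι) (i : ι) (g : G), E.paid.card ≤ N →
      E.Walk i g n i → beta g ≠ 0 → rho g = 0 → X (E.loops i) := by
    intro ι E i g hE hg hβ hr
    obtain ⟨m, hm, hlift⟩ := hg.exists_lift
    simp only [hr, add_zero] at hlift
    obtain ⟨x, hx⟩ : ∃ x, beta (sec g x) ≠ 0 := by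
      by_contra! h
      rw [← sum_beta_sec, h, h, h] at hβ
      exact hβ rfl
    refine mem_of_mem_sectionGraph hX hN hE (x := x) ?_
    have hE' := (card_paid_sectionGraph (E := E)).trans_le hE
    have hle : m x ≤ n := by
      have : m x = m 0 ∨ m x = m 1 ∨ m x = m 2 := by fin_cases x <;> simp
      omega
    rcases hle.lt_or_eq with hlt | heq
    · exact ih _ hlt _ _ _ hE' (hlift x).1 hx
    · exact mem_of_gb_mem_loops hX hN hE'
        (gb_mem_of_zpowers ((hlift x).2 heq) hx ⟨_, (hlift x).1⟩)
  intro ι E i g hE hg hβ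
  by_cases hr : rho g = 0
  · exact stab E i g hE hg hβ hr
  obtain ⟨m, hm, hlift⟩ := hg.exists_lift
  have perm : ∀ {M : Type} [AddCommMonoid M] (f : Fin 3 → M),
      f 0 + f (0 + rho g) + f (0 + rho g + rho g) = f 0 + f 1 + f 2 := by
    intro M _ f
    have hcases : ∀ r : Fin 3, r ≠ 0 → r = 1 ∨ r = 2 := by decide
    rcases hcases _ hr with h | h <;> rw [h]
    · rfl
    · change f 0 + f 2 + f 1 = _
      abel
  have h3 : (0 : Fin 3) + rho g + rho g + rho g = 0 := by
    generalize rho g = r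
    revert r
    decide
  -- When g rotates, its three lifts concatenate to a closed walk of the same cost n and the same
  -- exponent of b, whose label fixes the first level; the case `stab` applies to it.
  have hw := ((hlift 0).1.trans (hlift (0 + rho g)).1).trans (hlift (0 + rho g + rho g)).1
  rw [h3, perm m, hm] at hw
  refine mem_of_mem_sectionGraph hX hN hE (x := 0) ?_
  refine stab _ _ _ (card_paid_sectionGraph.trans_le hE) hw ?_ ?_
  · rw [beta_mul, beta_mul, add_comm, add_comm (beta _) (beta (sec g 0)),
      perm fun x => beta (sec g x), sum_beta_sec]
    exact hβ
  · rw [rho_mul, rho_mul, add_comm, add_comm (rho _) (rho (sec g 0)),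
      perm fun x => rho (sec g x), sum_rho_sec]

/-- If some section has a closed walk with nonzero exponent of b, `mem_of_beta_ne_zero` applies to
it. Otherwise `rho_sec_eq` shows that the sections fix the first level. -/
theorem mem_of_isInductive (hX : IsInductive X) (E : LabelledGraph ι) (i : ι) :
    X (E.loops i) := by
  suffices ∀ N, HoldsBelow X N from this _ E i (Nat.lt_succ_self _)
  intro N
  induction N with
  | zero => intro ι E i h; omega
  | succ N hN =>
    intro ι E i hE
    have hE : E.paid.card ≤ N := by omega
    have hE' := (card_paid_sectionGraph (E := E)).trans_le hE
    by_cases hβ : ∀ y, ∀ g ∈ E.sectionGraph.loops (i, y), beta g = 0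
    · refine mem_of_mem_sectionGraph hX hN hE (x := 0) ?_
      refine mem_of_stabilizing hX hN hE' fun h hh => ?_
      rw [← sectionSubgroup_loops] at hh
      obtain ⟨g, hg, hr, rfl⟩ := hh
      have h0 : ∀ y, beta (sec g y) = 0 := fun y => hβ y _ <| by
        rw [← sectionSubgroup_loops]
        exact ⟨g, hg, hr, rfl⟩
      rw [rho_sec_eq, h0, h0, sub_zero]
    · push Not at hβ
      obtain ⟨y, h, ⟨n, hh⟩, hβ⟩ := hβ
      exact mem_of_mem_sectionGraph hX hN hE (mem_of_beta_ne_zero hX hN n _ _ _ hE' hh hβ)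

/-- Every finitely generated subgroup of the Gupta–Sidki group belongs to every inductive
class. -/
theorem _root_.GuptaSidki.IsInductive.mem_of_fg (hX : IsInductive X) (H : Subgroup G)
    (hH : H.FG) : X H := by
  classical
  -- The Schreier graph of G/H with all its a-edges but only the b-edges in S.
  let F : Finset ((G ⧸ H) × (G ⧸ H)) → LabelledGraph (G ⧸ H) := fun S =>
    { edge := fun i s j => j = s • i ∧ (s ∈ Subgroup.zpowers ga ∨ (s = gb ∧ (i, j) ∈ S) ∨
        (s = gb⁻¹ ∧ (j, i) ∈ S))
      paid := S
      symm := by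
        rintro i s j ⟨rfl, h | ⟨rfl, h⟩ | ⟨rfl, h⟩⟩
        · exact ⟨by simp, Or.inl (inv_mem h)⟩
        · exact ⟨by simp, Or.inr (Or.inr ⟨rfl, h⟩)⟩
        · exact ⟨by simp, Or.inr (Or.inl ⟨by simp, h⟩)⟩
      label := fun h => h.2 }
  have mono : ∀ {S T i g n j}, S ⊆ T → (F S).Walk i g n j → (F T).Walk i g n j := by
    intro S T i g n j hST hw
    have hedge : ∀ {i s j}, (F S).edge i s j → (F T).edge i s j := by
      rintro i s j ⟨h0, h⟩
      exact ⟨h0, h.imp id (Or.imp (And.imp id fun h => hST h) (And.imp id fun h => hST h))⟩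
    induction hw with
    | nil => exact Walk.nil _
    | free _ he hs ih => exact ih.free (hedge he) hs
    | paid _ he hs ih => exact ih.paid (hedge he) hs
  have hexists : ∀ g : G, ∀ i, ∃ S n, (F S).Walk i g n (g • i) := by
    intro g
    induction g using induction_on with
    | one => exact fun i => ⟨∅, 0, by rw [one_smul]; exact Walk.nil _⟩
    | ha =>
      refine fun i => ⟨∅, ?_⟩
      exact exists_walk_of_edge ⟨rfl, Or.inl (Subgroup.mem_zpowers _)⟩
    | hb =>
      refine fun i => ⟨{(i, gb • i)}, ?_⟩
      exact exists_walk_of_edge ⟨rfl, Or.inr (Or.inl ⟨rfl, Finset.mem_singleton_self _⟩)⟩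
    | mul g h hg hh =>
      intro i
      obtain ⟨S, m, hS⟩ := hh i
      obtain ⟨T, n, hT⟩ := hg (h • i)
      rw [mul_smul]
      exact ⟨S ∪ T, _, (mono Finset.subset_union_left hS).trans
        (mono Finset.subset_union_right hT)⟩
    | inv g hg =>
      intro i
      obtain ⟨S, n, h⟩ := hg (g⁻¹ • i)
      rw [smul_inv_smul] at h
      exact ⟨S, n, h.symm⟩
  obtain ⟨T, rfl⟩ := hH
  -- Finitely many b-edges suffice to read all the generators from the base coset.
  choose S hS using fun g : G => hexists g ((1 : G) : G ⧸ Subgroup.closure (T : Set G))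
  have hloops : (F (T.biUnion S)).loops ((1 : G) : G ⧸ Subgroup.closure (T : Set G)) =
      Subgroup.closure (T : Set G) := by
    apply le_antisymm
    · have hw : ∀ {i g n j}, (F (T.biUnion S)).Walk i g n j → j = g • i := by
        intro i g n j hw
        induction hw with
        | nil => rw [one_smul]
        | free _ he _ ih => rw [he.1, ih, mul_smul]
        | paid _ he _ ih => rw [he.1, ih, mul_smul]
      rintro g ⟨n, hg⟩
      have := hw hg
      rw [MulAction.Quotient.smul_coe, smul_eq_mul, mul_one, QuotientGroup.eq, inv_one,
        one_mul] at this
      exact this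
    · rw [Subgroup.closure_le]
      intro g hg
      obtain ⟨n, hw⟩ := hS g
      have hfix : g • ((1 : G) : G ⧸ Subgroup.closure (T : Set G)) = (1 : G) := by
        rw [MulAction.Quotient.smul_coe, smul_eq_mul, mul_one, eq_comm, QuotientGroup.eq, inv_one,
          one_mul]
        exact Subgroup.subset_closure hg
      rw [hfix] at hw
      exact ⟨n, mono (Finset.subset_biUnion_of_mem S hg) hw⟩
  rw [← hloops]
  exact mem_of_isInductive hX _ _

end LabelledGraph

open scoped commutatorElement

/-! ### Level stabilizers and sections at words -/

/-- The pointwise stabilizer of a level of the tree. -/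
def levelStab : ℕ → Subgroup G
  | 0 => ⊤
  | n + 1 =>
    { carrier := {g | rho g = 0 ∧ ∀ x, sec g x ∈ levelStab n}
      one_mem' := ⟨rho_one, fun x => by rw [sec_one]; exact one_mem _⟩
      mul_mem' := fun {g h} hg hh => ⟨by rw [rho_mul, hg.1, hh.1, add_zero],
        fun x => by rw [sec_mul]; exact mul_mem (hg.2 _) (hh.2 _)⟩
      inv_mem' := fun {g} hg => ⟨by rw [rho_inv, hg.1, neg_zero],
        fun x => by rw [sec_inv]; exact inv_mem (hg.2 _)⟩ }

theorem mem_levelStab_succ {n : ℕ} {g : G} :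
    g ∈ levelStab (n + 1) ↔ rho g = 0 ∧ ∀ x, sec g x ∈ levelStab n := Iff.rfl

theorem mem_levelStab_one {g : G} : g ∈ levelStab 1 ↔ rho g = 0 :=
  ⟨fun h => h.1, fun h => ⟨h, fun _ => trivial⟩⟩

instance levelStab_normal (n : ℕ) : (levelStab n).Normal := by
  induction n with
  | zero => exact inferInstanceAs (⊤ : Subgroup G).Normal
  | succ n ih =>
    refine ⟨fun g hg s => ⟨?_, fun x => ?_⟩⟩
    · rw [rho_mul, rho_mul, rho_inv, hg.1, add_zero, add_neg_cancel]
    · have := sec_conj s g (x - rho s) hg.1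
      rw [sub_add_cancel] at this
      rw [this]
      exact ih.conj_mem _ (hg.2 _) _

theorem levelStab_succ_le (n : ℕ) : levelStab (n + 1) ≤ levelStab n := by
  induction n with
  | zero => exact le_top
  | succ n ih => exact fun g hg => ⟨hg.1, fun x => ih (hg.2 x)⟩

theorem levelStab_antitone : Antitone levelStab := antitone_nat_of_succ_le levelStab_succ_le

/-- The section of an element at a vertex of the tree. -/
noncomputable def secw : G → Vertex → G
  | g, [] => g
  | g, x :: v => secw (sec g x) v

@[simp] theorem secw_nil (g : G) : secw g [] = g := rfl

@[simp] theorem secw_cons (g : G) (x : Fin 3) (v : Vertex) :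
    secw g (x :: v) = secw (sec g x) v := rfl

theorem apply_nil (g : G) : (g : TreeAut) [] = [] := (isWreath g).1

theorem apply_cons (g : G) (x : Fin 3) (v : Vertex) :
    (g : TreeAut) (x :: v) = (x + rho g) :: (sec g x : TreeAut) v := (isWreath g).2 x v

theorem length_apply (g : G) (v : Vertex) : ((g : TreeAut) v).length = v.length := by
  induction v generalizing g with
  | nil => rw [apply_nil]
  | cons x v ih => rw [apply_cons, List.length_cons, List.length_cons, ih]

theorem secw_mul (g h : G) (v : Vertex) :
    secw (g * h) v = secw g ((h : TreeAut) v) * secw h v := by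
  induction v generalizing g h with
  | nil => rw [apply_nil]; rfl
  | cons x v ih => rw [apply_cons, secw_cons, sec_mul, ih, secw_cons, secw_cons]

@[simp] theorem secw_one (v : Vertex) : secw 1 v = 1 := by
  induction v with
  | nil => rfl
  | cons x v ih => rw [secw_cons, sec_one, ih]

theorem apply_eq_of_mem_levelStab {n : ℕ} {g : G} (hg : g ∈ levelStab n) {v : Vertex}
    (hv : v.length ≤ n) : (g : TreeAut) v = v := by
  induction v generalizing g n with
  | nil => exact apply_nil g
  | cons x v ih =>
    cases n with
    | zero => simp at hv
    | succ n => rw [apply_cons, hg.1, add_zero, ih (hg.2 x) (by simpa using hv)]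

theorem mem_levelStab_of_apply_eq {n : ℕ} {g : G}
    (h : ∀ v : Vertex, v.length = n → (g : TreeAut) v = v) : g ∈ levelStab n := by
  induction n generalizing g with
  | zero => trivial
  | succ n ih =>
    refine ⟨?_, fun x => ih fun v hv => ?_⟩
    · have := h (0 :: List.replicate n 0) (by simp)
      rw [apply_cons] at this
      simpa using (List.cons.inj this).1
    · have := h (x :: v) (by simpa using hv)
      rw [apply_cons] at this
      exact (List.cons.inj this).2

theorem exists_notMem_levelStab {g : G} (hg : g ≠ 1) : ∃ n, g ∉ levelStab n := by
  by_contra! h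
  refine hg (Subtype.ext ?_)
  ext1 v
  exact apply_eq_of_mem_levelStab (h v.length) le_rfl

theorem eq_one_of_secw_eq_one {n : ℕ} {g : G} (hg : g ∈ levelStab n)
    (h : ∀ v : Vertex, v.length = n → secw g v = 1) : g = 1 := by
  induction n generalizing g with
  | zero => exact h [] rfl
  | succ n ih =>
    refine ext_sec (by rw [hg.1, rho_one]) fun x => ?_
    rw [sec_one]
    exact ih (hg.2 x) fun v hv => h (x :: v) (by simpa using hv)

theorem mem_levelStab_add {k m : ℕ} {g : G} : g ∈ levelStab (k + m) ↔
    g ∈ levelStab k ∧ ∀ v : Vertex, v.length = k → secw g v ∈ levelStab m := by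
  induction k generalizing g with
  | zero =>
    rw [zero_add]
    refine ⟨fun h => ⟨trivial, fun v hv => ?_⟩, fun h => h.2 [] rfl⟩
    rw [List.length_eq_zero_iff.1 hv]
    exact h
  | succ k ih =>
    rw [add_right_comm, mem_levelStab_succ, mem_levelStab_succ]
    refine ⟨fun h => ⟨⟨h.1, fun x => (ih.1 (h.2 x)).1⟩, ?_⟩, fun h => ⟨h.1.1, fun x => ?_⟩⟩
    · rintro (_ | ⟨x, v⟩) hv
      · simp at hv
      · exact (ih.1 (h.2 x)).2 v (by simpa using hv)
    · exact ih.2 ⟨h.1.2 x, fun v hv => h.2 (x :: v) (by simpa using hv)⟩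

/-- The sections at the vertices of a level, on the stabilizer of the level. -/
noncomputable def sections (n : ℕ) : levelStab n →* (List.Vector (Fin 3) n → G) where
  toFun g v := secw g v.1
  map_one' := funext fun v => secw_one _
  map_mul' g h := funext fun v => by
    change secw (g * h : G) v.1 = _
    rw [secw_mul, apply_eq_of_mem_levelStab h.2 v.2.le]
    rfl

theorem sections_injective (n : ℕ) : Function.Injective (sections n) := by
  rw [injective_iff_map_eq_one]
  intro g hg
  exact Subtype.ext (eq_one_of_secw_eq_one g.2 fun v hv => congrFun hg ⟨v, hv⟩)

/-! ### The abelianization -/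

/-- The rotation of the first level, as a homomorphism. -/
noncomputable def rhoHom : G →* Multiplicative (Fin 3) where
  toFun g := Multiplicative.ofAdd (rho g)
  map_one' := by simp
  map_mul' g h := by rw [rho_mul]; rfl

/-- The exponent of `b`, as a homomorphism. -/
noncomputable def betaHom : G →* Multiplicative (Fin 3) where
  toFun g := Multiplicative.ofAdd (beta g)
  map_one' := by simp
  map_mul' g h := by rw [beta_mul]; rfl

theorem pow_val_add {M : Type*} [Monoid M] {c : M} (hc : c ^ 3 = 1) (x y : Fin 3) :
    c ^ (x + y).val = c ^ x.val * c ^ y.val := by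
  rw [Fin.val_add, ← pow_add]
  conv_rhs => rw [← Nat.mod_add_div (x.val + y.val) 3, pow_add, pow_mul, hc, one_pow, mul_one]

theorem abelianization_of_eq (g : G) : Abelianization.of g =
    Abelianization.of ga ^ (rho g).val * Abelianization.of gb ^ (beta g).val := by
  have ha : Abelianization.of ga ^ 3 = 1 := by rw [← map_pow, ga_pow_three, map_one]
  have hb : Abelianization.of gb ^ 3 = 1 := by rw [← map_pow, gb_pow_three, map_one]
  have hmul : ∀ g h : G,
      Abelianization.of ga ^ (rho (g * h)).val * Abelianization.of gb ^ (beta (g * h)).val =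
      (Abelianization.of ga ^ (rho g).val * Abelianization.of gb ^ (beta g).val) *
      (Abelianization.of ga ^ (rho h).val * Abelianization.of gb ^ (beta h).val) := by
    intro g h
    rw [rho_mul, beta_mul, pow_val_add ha, pow_val_add hb, mul_mul_mul_comm]
  induction g using induction_on with
  | one => simp
  | ha => simp
  | hb => simp
  | mul g h hg hh => rw [hmul, map_mul, hg, hh]
  | inv g hg =>
    have := hmul g g⁻¹
    rw [mul_inv_cancel, rho_one, beta_one, ← hg] at this
    rw [map_inv]
    simp only [Fin.val_zero, pow_zero, mul_one] at this
    exact inv_eq_of_mul_eq_one_right this.symm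

theorem mem_commutator_iff {g : G} : g ∈ commutator G ↔ rho g = 0 ∧ beta g = 0 := by
  constructor
  · intro hg
    exact ⟨Abelianization.commutator_subset_ker rhoHom hg,
      Abelianization.commutator_subset_ker betaHom hg⟩
  · rintro ⟨h1, h2⟩
    have := abelianization_of_eq g
    rw [h1, h2] at this
    simp only [Fin.val_zero, pow_zero, mul_one] at this
    rw [← Abelianization.ker_of]
    exact this

instance finiteIndex_commutator : (commutator G).FiniteIndex := by
  have : commutator G = rhoHom.ker ⊓ betaHom.ker := by
    ext g
    exact mem_commutator_iff
  rw [this]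
  have : Finite (Multiplicative (Fin 3)) := inferInstanceAs (Finite (Fin 3))
  infer_instance

theorem levelStab_two_le : levelStab 2 ≤ commutator G := fun g hg =>
  mem_commutator_iff.2 ⟨hg.1, by rw [beta, (hg.2 2).1, (hg.2 1).1, sub_zero]⟩

/-! ### The branch structure -/

/-- The elements `g` such that `M` contains the element with section `g` at the vertex `x` of
the first level and trivial sections at the other vertices of the first level. -/
def copyAt (x : Fin 3) (M : Subgroup G) : Subgroup G where
  carrier := {g | ∃ h ∈ M, rho h = 0 ∧ sec h = Pi.mulSingle x g}
  one_mem' := ⟨1, one_mem M, rho_one, by rw [Pi.mulSingle_one]; exact funext sec_one⟩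
  mul_mem' := by
    rintro g g' ⟨h, hM, hr, hs⟩ ⟨h', hM', hr', hs'⟩
    refine ⟨h * h', mul_mem hM hM', by rw [rho_mul, hr, hr', add_zero], ?_⟩
    rw [Pi.mulSingle_mul, ← hs, ← hs']
    funext y
    rw [sec_mul, hr', add_zero]
    rfl
  inv_mem' := by
    rintro g ⟨h, hM, hr, hs⟩
    refine ⟨h⁻¹, inv_mem hM, by rw [rho_inv, hr, neg_zero], ?_⟩
    rw [Pi.mulSingle_inv, ← hs]
    funext y
    rw [sec_inv, hr, sub_zero]
    rfl

theorem conj_mem_copyAt {M : Subgroup G} [M.Normal] {x : Fin 3} {g : G} (hg : g ∈ copyAt x M)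
    (s : G) : sec s x * g * (sec s x)⁻¹ ∈ copyAt (x + rho s) M := by
  obtain ⟨h, hM, hr, hs⟩ := hg
  refine ⟨s * h * s⁻¹, Subgroup.Normal.conj_mem inferInstance h hM s, ?_, ?_⟩
  · rw [rho_mul, rho_mul, rho_inv, hr, add_zero, add_neg_cancel]
  · funext y
    obtain ⟨z, rfl⟩ : ∃ z, y = z + rho s := ⟨y - rho s, (sub_add_cancel _ _).symm⟩
    rw [sec_conj s h z hr, hs]
    by_cases hz : z = x
    · subst hz
      rw [Pi.mulSingle_eq_same, Pi.mulSingle_eq_same]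
    · rw [Pi.mulSingle_eq_of_ne hz, Pi.mulSingle_eq_of_ne (by simpa using hz), mul_one,
        mul_inv_cancel]

theorem rho_pow_ga (x : Fin 3) : rho (ga ^ x.val) = x := by
  fin_cases x <;> simp [pow_succ, rho_mul]

theorem sec_pow_ga (n : ℕ) (x : Fin 3) : sec (ga ^ n) x = 1 :=
  sec_of_mem_zpowers_ga (Subgroup.npow_mem_zpowers _ _) x

theorem rho_conj_pow_ga (k : ℕ) : rho (ga ^ k * gb * (ga ^ k)⁻¹) = 0 := by
  rw [rho_mul, rho_mul, rho_gb, rho_inv, add_zero, add_neg_cancel]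

theorem sec_conj_pow_ga (k : ℕ) (y : Fin 3) :
    sec (ga ^ k * gb * (ga ^ k)⁻¹) y = sec gb (y - rho (ga ^ k)) := by
  have := sec_conj (ga ^ k) gb (y - rho (ga ^ k)) rho_gb
  rwa [sub_add_cancel, sec_pow_ga, one_mul, inv_one, mul_one] at this

theorem copyAt_le {M : Subgroup G} [M.Normal] (x y : Fin 3) : copyAt x M ≤ copyAt y M := by
  intro g hg
  have := conj_mem_copyAt hg (ga ^ (y - x).val)
  rwa [sec_pow_ga, rho_pow_ga, add_sub_cancel, one_mul, inv_one, mul_one] at this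

theorem exists_mem_levelStab_one_sec_eq (x : Fin 3) (g : G) :
    ∃ h ∈ levelStab 1, sec h x = g := by
  have hφ : sectionSubgroup ⊤ x = ⊤ := by
    have hb : ∀ y, sec gb y ∈ sectionSubgroup ⊤ x := fun y => by
      refine ⟨ga ^ (x - y).val * gb * (ga ^ (x - y).val)⁻¹, trivial, ?_, ?_⟩
      · rw [rho_mul, rho_mul, rho_gb, rho_inv, add_zero, add_neg_cancel]
      · have := sec_conj (ga ^ (x - y).val) gb y rho_gb
        rwa [rho_pow_ga, add_sub_cancel, sec_pow_ga, one_mul, inv_one, mul_one] at this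
    exact eq_top_of_ga_gb_mem (by simpa using hb 0) (by simpa using hb 2)
  obtain ⟨h, -, hr, hs⟩ : g ∈ sectionSubgroup ⊤ x := by rw [hφ]; trivial
  exact ⟨h, mem_levelStab_one.2 hr, hs⟩

instance copyAt_normal {M : Subgroup G} [M.Normal] (x : Fin 3) : (copyAt x M).Normal := by
  refine ⟨fun g hg s => ?_⟩
  obtain ⟨h, hr, rfl⟩ := exists_mem_levelStab_one_sec_eq x s
  have := conj_mem_copyAt hg h
  rwa [mem_levelStab_one.1 hr, add_zero] at this

/-- Modulo N the two generators commute, so the quotient is abelian. -/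
theorem commutator_le_of_closure_pair {Γ : Type*} [Group Γ] {u v : Γ}
    (huv : Subgroup.closure {u, v} = ⊤) {N : Subgroup Γ} [N.Normal] (h : ⁅u, v⁆ ∈ N) :
    commutator Γ ≤ N := by
  let π := QuotientGroup.mk' N
  have hcomm : π u * π v = π v * π u := by
    rw [← commutatorElement_eq_one_iff_mul_comm, ← map_commutatorElement]
    exact (QuotientGroup.eq_one_iff _).2 h
  have key : ∀ K : Subgroup (Γ ⧸ N), π u ∈ K → π v ∈ K → ∀ g, π g ∈ K := by
    intro K hu hv g
    have : Subgroup.closure {u, v} ≤ K.comap π := by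
      rw [Subgroup.closure_le]
      rintro x (rfl | rfl)
      · exact hu
      · exact hv
    exact this (huv ▸ trivial)
  have hu : ∀ g, π g * π u = π u * π g := fun g => (Subgroup.mem_centralizer_singleton_iff.1
    (key (Subgroup.centralizer {π u}) (Subgroup.mem_centralizer_singleton_iff.2 rfl)
      (Subgroup.mem_centralizer_singleton_iff.2 hcomm.symm) g))
  have hv : ∀ g, π g * π v = π v * π g := fun g => (Subgroup.mem_centralizer_singleton_iff.1
    (key (Subgroup.centralizer {π v}) (Subgroup.mem_centralizer_singleton_iff.2 hcomm)
      (Subgroup.mem_centralizer_singleton_iff.2 rfl) g))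
  rw [commutator_eq_closure, Subgroup.closure_le]
  rintro _ ⟨g, h, rfl⟩
  have hgh : π g * π h = π h * π g := (Subgroup.mem_centralizer_singleton_iff.1
    (key (Subgroup.centralizer {π h}) (Subgroup.mem_centralizer_singleton_iff.2 (hu h).symm)
      (Subgroup.mem_centralizer_singleton_iff.2 (hv h).symm) g))
  rw [← commutatorElement_eq_one_iff_mul_comm, ← map_commutatorElement] at hgh
  exact (QuotientGroup.eq_one_iff _).1 hgh

/-- G is regular branch over G'. With bₖ = aᵏba⁻ᵏ one has b₀b₁ = (ab, 1, ba⁻¹) and b₁b₂ = (ba⁻¹, ab,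
1), whose commutator is ([ab, ba⁻¹], 1, 1). As ab and ba⁻¹ generate G, this commutator normally
generates G'. -/
theorem commutator_le_copyAt (x : Fin 3) :
    commutator G ≤ copyAt x ⁅levelStab 1, levelStab 1⁆ := by
  refine le_trans ?_ (copyAt_le 0 x)
  have huv : Subgroup.closure {ga * gb, gb * ga⁻¹} = (⊤ : Subgroup G) := by
    have hu : ga * gb ∈ Subgroup.closure {ga * gb, gb * ga⁻¹} :=
      Subgroup.subset_closure (by simp)
    have hv : gb * ga⁻¹ ∈ Subgroup.closure {ga * gb, gb * ga⁻¹} :=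
      Subgroup.subset_closure (by simp)
    have hbb : gb * gb = gb⁻¹ := by
      rw [eq_inv_iff_mul_eq_one, ← gb_pow_three, pow_succ, sq]
    have hw : ga * gb * ga⁻¹ ∈ Subgroup.closure {ga * gb, gb * ga⁻¹} := by
      have : ga * gb * ga⁻¹ = (ga * gb * (gb * ga⁻¹))⁻¹ := by
        rw [show ga * gb * (gb * ga⁻¹) = ga * (gb * gb) * ga⁻¹ by group, hbb]
        group
      rw [this]
      exact inv_mem (mul_mem hu hv)
    have ha : ga ∈ Subgroup.closure {ga * gb, gb * ga⁻¹} := by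
      have := mul_mem hw (inv_mem hv)
      simpa [mul_assoc] using this
    refine eq_top_of_ga_gb_mem ha ?_
    have := mul_mem (inv_mem ha) hu
    simpa using this
  refine commutator_le_of_closure_pair huv ?_
  have hr := rho_conj_pow_ga
  have hsec := sec_conj_pow_ga
  have h1 : rho (ga ^ 1) = 1 := rho_pow_ga 1
  have h2 : rho (ga ^ 2) = 2 := rho_pow_ga 2
  refine ⟨⁅gb * (ga ^ 1 * gb * (ga ^ 1)⁻¹),
    (ga ^ 1 * gb * (ga ^ 1)⁻¹) * (ga ^ 2 * gb * (ga ^ 2)⁻¹)⁆,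
    Subgroup.commutator_mem_commutator (mem_levelStab_one.2 ?_) (mem_levelStab_one.2 ?_),
    ?_, ?_⟩
  · rw [rho_mul, hr, rho_gb, add_zero]
  · rw [rho_mul, hr, hr, add_zero]
  · simp only [commutatorElement_def, rho_mul, rho_inv, hr, rho_gb, add_zero, neg_zero]
  · funext y
    simp only [commutatorElement_def, sec_mul, sec_inv, rho_mul, rho_inv, hr, rho_gb, add_zero,
      neg_zero, sub_zero, hsec, h1, h2]
    fin_cases y
    · simp [show (-1 : Fin 3) = 2 from rfl, show (-2 : Fin 3) = 1 from rfl, mul_assoc]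
    · simp
    · simp

/-- The stabilizer is ⟨b⟩G', and G' is central modulo [G', G], so its image there is abelian. -/
theorem commutator_levelStab_one_le : ⁅levelStab 1, levelStab 1⁆ ≤ ⁅commutator G, ⊤⁆ := by
  rw [Subgroup.commutator_le]
  let π := QuotientGroup.mk' ⁅commutator G, (⊤ : Subgroup G)⁆
  have central : ∀ c ∈ commutator G, ∀ g, Commute (π c) (π g) := by
    intro c hc g
    rw [← commutatorElement_eq_one_iff_commute, ← map_commutatorElement]
    exact (QuotientGroup.eq_one_iff _).2 (Subgroup.commutator_mem_commutator hc trivial)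
  have decomp : ∀ g ∈ levelStab 1, ∃ k : ℕ, ∃ c ∈ commutator G, g = gb ^ k * c := by
    intro g hg
    have hr : ∀ k : ℕ, rho (gb ^ k) = 0 := fun k =>
      rho_of_mem_zpowers_gb (Subgroup.npow_mem_zpowers _ _)
    have hβ : ∀ x : Fin 3, beta (gb ^ x.val) = x := fun x => by
      fin_cases x <;> simp [pow_succ, beta_mul]
    refine ⟨(beta g).val, (gb ^ (beta g).val)⁻¹ * g, mem_commutator_iff.2 ⟨?_, ?_⟩, by group⟩
    · rw [rho_mul, rho_inv, hr, mem_levelStab_one.1 hg, neg_zero, add_zero]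
    · rw [beta_mul, beta_inv, hβ, neg_add_cancel]
  intro g hg h hh
  obtain ⟨k, c, hc, rfl⟩ := decomp g hg
  obtain ⟨l, d, hd, rfl⟩ := decomp h hh
  have hcomm : Commute (π (gb ^ k * c)) (π (gb ^ l * d)) := by
    rw [map_mul π (gb ^ k)]
    refine Commute.mul_left ?_ (central c hc _)
    rw [map_mul]
    refine Commute.mul_right ?_ (central d hd _).symm
    rw [map_pow, map_pow]
    exact (Commute.refl _).pow_pow _ _
  rw [← commutatorElement_eq_one_iff_commute, ← map_commutatorElement] at hcomm
  exact (QuotientGroup.eq_one_iff _).1 hcomm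

/-- The elements b₁b₀⁻¹ and b₂b₁⁻¹ of G' have sections ba⁻¹ and a⁻¹b⁻¹ at 0, which generate G
because a³ = 1. -/
theorem sectionSubgroup_commutator : sectionSubgroup (commutator G) 0 = ⊤ := by
  have hβ : ∀ k : ℕ, beta (ga ^ k * gb * (ga ^ k)⁻¹) = 1 := fun k => by
    rw [beta_mul, beta_mul, beta_gb, beta_inv, add_neg_cancel_comm]
  have h0 : rho (ga ^ 0) = 0 := rho_pow_ga 0
  have h1 : rho (ga ^ 1) = 1 := rho_pow_ga 1
  have h2 : rho (ga ^ 2) = 2 := rho_pow_ga 2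
  have key : ∀ k l : ℕ, sec gb (0 - rho (ga ^ k)) * (sec gb (0 - rho (ga ^ l)))⁻¹ ∈
      sectionSubgroup (commutator G) 0 := by
    intro k l
    refine ⟨(ga ^ k * gb * (ga ^ k)⁻¹) * (ga ^ l * gb * (ga ^ l)⁻¹)⁻¹,
      mem_commutator_iff.2 ⟨?_, ?_⟩, ?_, ?_⟩
    · rw [rho_mul, rho_inv, rho_conj_pow_ga, rho_conj_pow_ga, neg_zero, add_zero]
    · rw [beta_mul, beta_inv, hβ, hβ, add_neg_cancel]
    · rw [rho_mul, rho_inv, rho_conj_pow_ga, rho_conj_pow_ga, neg_zero, add_zero]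
    · rw [sec_mul, sec_inv, rho_inv, rho_conj_pow_ga, neg_zero, add_zero, sub_zero, sec_conj_pow_ga, sec_conj_pow_ga]
  have k1 : gb * ga⁻¹ ∈ sectionSubgroup (commutator G) 0 := by
    simpa [h1, h0, show (-1 : Fin 3) = 2 from rfl] using key 1 0
  have k2 : ga⁻¹ * gb⁻¹ ∈ sectionSubgroup (commutator G) 0 := by
    simpa [h1, h2, show (-1 : Fin 3) = 2 from rfl, show (-2 : Fin 3) = 1 from rfl] using key 2 1
  have hb : gb ∈ sectionSubgroup (commutator G) 0 := by
    have h3 : ga⁻¹ * ga⁻¹ * ga⁻¹ = 1 := by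
      rw [← inv_one, ← ga_pow_three]
      group
    have := mul_mem (mul_mem k1 k2) k1
    rwa [show gb * ga⁻¹ * (ga⁻¹ * gb⁻¹) * (gb * ga⁻¹) = gb * (ga⁻¹ * ga⁻¹ * ga⁻¹) by group, h3,
      mul_one] at this
  have ha : ga ∈ sectionSubgroup (commutator G) 0 := by
    have := mul_mem (inv_mem k1) hb
    simpa using this
  exact eq_top_of_ga_gb_mem ha hb

/-- For ξ in G', take η = (ξ, 1, 1) in G' and t in G' with section s at 0; then [η, t] = ([ξ, s], 1,
1) lies in G''. -/
theorem commutator_top_le_copyAt (x : Fin 3) :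
    ⁅commutator G, ⊤⁆ ≤ copyAt x ⁅commutator G, commutator G⁆ := by
  refine le_trans ?_ (copyAt_le 0 x)
  rw [Subgroup.commutator_le]
  intro ξ hξ s _
  obtain ⟨η, hη, hηr, hηs⟩ := commutator_le_copyAt 0 hξ
  obtain ⟨t, ht, htr, rfl⟩ : s ∈ sectionSubgroup (commutator G) 0 := by
    rw [sectionSubgroup_commutator]; trivial
  have hD : ⁅levelStab 1, levelStab 1⁆ ≤ commutator G := by
    rw [commutator_def]
    exact Subgroup.commutator_mono le_top le_top
  refine ⟨⁅η, t⁆, Subgroup.commutator_mem_commutator (hD hη) ht, ?_, ?_⟩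
  · simp [commutatorElement_def, rho_mul, hηr, htr]
  · funext y
    simp only [commutatorElement_def, sec_mul, sec_inv, rho_inv, hηr, htr, neg_zero, add_zero,
      sub_zero, hηs]
    by_cases hy : y = 0
    · subst hy
      simp
    · simp [hy]

/-! ### Elements supported on one subtree -/

/-- `η` acts on the subtree at `v` as `ξ`, and fixes the rest of the tree. -/
def IsPlaced (v : Vertex) (ξ η : G) : Prop :=
  η ∈ levelStab v.length ∧ ∀ u : Vertex, u.length = v.length → secw η u = if u = v then ξ else 1

theorem IsPlaced.cons {v : Vertex} {ξ η ζ : G} (h : IsPlaced v ξ η) {x : Fin 3}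
    (hr : rho ζ = 0) (hs : sec ζ = Pi.mulSingle x η) : IsPlaced (x :: v) ξ ζ := by
  refine ⟨⟨hr, fun y => ?_⟩, ?_⟩
  · rw [hs]
    by_cases hy : y = x
    · subst hy
      rw [Pi.mulSingle_eq_same]
      exact h.1
    · rw [Pi.mulSingle_eq_of_ne hy]
      exact one_mem _
  · rintro (_ | ⟨y, u⟩) hu
    · simp at hu
    · rw [secw_cons, hs]
      by_cases hy : y = x
      · subst hy
        rw [Pi.mulSingle_eq_same, h.2 u (by simpa using hu)]
        simp
      · rw [Pi.mulSingle_eq_of_ne hy, secw_one, if_neg (by simp [hy])]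

theorem isPlaced_nil (ξ : G) : IsPlaced [] ξ ξ :=
  ⟨trivial, fun u hu => by rw [List.length_eq_zero_iff.1 hu]; rfl⟩

theorem exists_isPlaced (v : Vertex) {ξ : G} (hξ : ξ ∈ commutator G) :
    ∃ η ∈ commutator G, IsPlaced v ξ η := by
  have hD : ⁅levelStab 1, levelStab 1⁆ ≤ commutator G := by
    rw [commutator_def]
    exact Subgroup.commutator_mono le_top le_top
  induction v with
  | nil => exact ⟨ξ, hξ, isPlaced_nil ξ⟩
  | cons x v ih =>
    obtain ⟨η, hη, h⟩ := ih
    obtain ⟨ζ, hζ, hr, hs⟩ := commutator_le_copyAt x hη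
    exact ⟨ζ, hD hζ, h.cons hr hs⟩

theorem exists_isPlaced_two {v : Vertex} (hv : v.length = 2) {ξ : G} (hξ : ξ ∈ commutator G) :
    ∃ η ∈ ⁅commutator G, commutator G⁆, IsPlaced v ξ η := by
  obtain ⟨x, y, rfl⟩ := List.length_eq_two.1 hv
  obtain ⟨η, hη, hr, hs⟩ := commutator_le_copyAt y hξ
  obtain ⟨ζ, hζ, hr', hs'⟩ := commutator_top_le_copyAt x (commutator_levelStab_one_le hη)
  exact ⟨ζ, hζ, ((isPlaced_nil ξ).cons hr hs).cons hr' hs'⟩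

theorem IsPlaced.sections_eq {n : ℕ} {v : List.Vector (Fin 3) n} {ξ η : G}
    (h : IsPlaced v.1 ξ η) (hη : η ∈ levelStab n) :
    sections n ⟨η, hη⟩ = Pi.mulSingle v ξ := by
  funext u
  change secw η u.1 = _
  rw [h.2 u.1 (u.2.trans v.2.symm)]
  by_cases hu : u = v
  · subst hu
    rw [if_pos rfl, Pi.mulSingle_eq_same]
  · rw [if_neg fun h => hu (Subtype.ext h), Pi.mulSingle_eq_of_ne hu]

/-- An element of a level stabilizer is the product of its sections, each placed at its own vertex.
-/
theorem mem_of_isPlaced {M : Subgroup G} {n : ℕ} {g : G} (hg : g ∈ levelStab n)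
    (h : ∀ v : Vertex, v.length = n → ∃ η ∈ M, IsPlaced v (secw g v) η) : g ∈ M := by
  have key : sections n ⟨g, hg⟩ ∈ (M.subgroupOf (levelStab n)).map (sections n) := by
    refine Subgroup.pi_mem_of_mulSingle_mem _ fun v => ?_
    obtain ⟨η, hη, hp⟩ := h v.1 v.2
    have hη' : η ∈ levelStab n := by simpa [v.2] using hp.1
    exact ⟨⟨η, hη'⟩, hη, hp.sections_eq hη'⟩
  obtain ⟨m, hm, heq⟩ := key
  have := sections_injective n heq
  subst this
  exact hm

theorem levelStab_four_le : levelStab 4 ≤ ⁅commutator G, commutator G⁆ := by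
  intro g hg
  have hg' := (mem_levelStab_add (k := 2) (m := 2)).1 hg
  exact mem_of_isPlaced hg'.1 fun v hv =>
    exists_isPlaced_two hv (levelStab_two_le (hg'.2 v hv))

theorem secw_inv {n : ℕ} {g : G} (hg : g ∈ levelStab n) {v : Vertex} (hv : v.length = n) :
    secw g⁻¹ v = (secw g v)⁻¹ := by
  rw [eq_inv_iff_mul_eq_one]
  have := secw_mul g⁻¹ g v
  rw [inv_mul_cancel, secw_one, apply_eq_of_mem_levelStab hg hv.le] at this
  exact this.symm

theorem secw_conj (s : G) {g : G} {v : Vertex} (hg : g ∈ levelStab v.length) :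
    secw (s * g * s⁻¹) ((s : TreeAut) v) = secw s v * secw g v * (secw s v)⁻¹ := by
  rw [eq_mul_inv_iff_mul_eq]
  have h1 := secw_mul (s * g * s⁻¹) s v
  rw [inv_mul_cancel_right, secw_mul, apply_eq_of_mem_levelStab hg le_rfl] at h1
  exact h1.symm

theorem IsPlaced.conj {v : Vertex} {ξ η : G} (h : IsPlaced v ξ η) (s : G) :
    IsPlaced ((s : TreeAut) v) (secw s v * ξ * (secw s v)⁻¹) (s * η * s⁻¹) := by
  refine ⟨?_, fun u hu => ?_⟩
  · rw [length_apply]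
    exact (levelStab_normal _).conj_mem _ h.1 s
  · obtain ⟨w, rfl⟩ : ∃ w, u = (s : TreeAut) w := ⟨(s⁻¹ : TreeAut) u, by simp⟩
    rw [length_apply, length_apply] at hu
    rw [secw_conj s (hu ▸ h.1), h.2 w hu]
    by_cases hw : w = v
    · subst hw
      simp
    · rw [if_neg hw, if_neg (by simpa using hw), mul_one, mul_inv_cancel]

theorem IsPlaced.commute {u v : Vertex} {ξ η ξ' η' : G} (h : IsPlaced u ξ η)
    (h' : IsPlaced v ξ' η') (hlen : u.length = v.length) (huv : u ≠ v) : Commute η η' := by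
  have hη' : η' ∈ levelStab u.length := hlen ▸ h'.1
  have e1 := h.sections_eq (v := ⟨u, rfl⟩) h.1
  have e2 := h'.sections_eq (v := ⟨v, hlen.symm⟩) hη'
  have hc : Commute (sections u.length ⟨η, h.1⟩) (sections u.length ⟨η', hη'⟩) := by
    rw [e1, e2]
    exact Pi.mulSingle_commute (fun h => huv (congrArg Subtype.val h)) _ _
  have := sections_injective _ (((map_mul _ _ _).trans hc.eq).trans (map_mul _ _ _).symm)
  exact congrArg Subtype.val this

theorem IsPlaced.mul {v : Vertex} {ξ η ξ' η' : G} (h : IsPlaced v ξ η) (h' : IsPlaced v ξ' η') :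
    IsPlaced v (ξ * ξ') (η * η') := by
  refine ⟨mul_mem h.1 h'.1, fun u hu => ?_⟩
  rw [secw_mul, apply_eq_of_mem_levelStab h'.1 hu.le, h.2 u hu, h'.2 u hu]
  split_ifs <;> simp

theorem IsPlaced.inv {v : Vertex} {ξ η : G} (h : IsPlaced v ξ η) : IsPlaced v ξ⁻¹ η⁻¹ := by
  refine ⟨inv_mem h.1, fun u hu => ?_⟩
  rw [secw_inv h.1 hu, h.2 u hu]
  split_ifs <;> simp

theorem isPlaced_one (v : Vertex) : IsPlaced v 1 1 :=
  ⟨one_mem _, fun u _ => by simp⟩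

theorem IsPlaced.commutatorElement {v : Vertex} {ξ η ξ' η' : G} (h : IsPlaced v ξ η)
    (h' : IsPlaced v ξ' η') : IsPlaced v ⁅ξ, ξ'⁆ ⁅η, η'⁆ :=
  ((h.mul h').mul h.inv).mul h'.inv

theorem exists_apply_eq (u v : Vertex) (h : u.length = v.length) :
    ∃ g : G, (g : TreeAut) u = v := by
  induction u generalizing v with
  | nil =>
    rw [List.length_eq_zero_iff.1 h.symm]
    exact ⟨1, rfl⟩
  | cons x u ih =>
    cases v with
    | nil => simp at h
    | cons y v =>
      obtain ⟨g, hg⟩ := ih v (by simpa using h)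
      obtain ⟨k, hk, rfl⟩ := exists_mem_levelStab_one_sec_eq x g
      refine ⟨ga ^ (y - x).val * k, ?_⟩
      rw [apply_cons, rho_mul, mem_levelStab_one.1 hk, rho_pow_ga, sec_mul, sec_pow_ga, one_mul,
        hg]
      simp

theorem exists_apply_ne {g : G} (hg : g ≠ 1) (n : ℕ) :
    ∃ v : Vertex, n ≤ v.length ∧ (g : TreeAut) v ≠ v := by
  obtain ⟨m, hm⟩ := exists_notMem_levelStab hg
  have : g ∉ levelStab (max m n) := fun h => hm (levelStab_antitone (le_max_left _ _) h)
  by_contra! h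
  exact this (mem_levelStab_of_apply_eq fun v hv => h v (hv ▸ le_max_right _ _))

/-! ### Normal subgroups and sections of level stabilizers -/

/-- Every nontrivial normal subgroup contains the stabilizer of a level. -/
theorem exists_levelStab_le {N : Subgroup G} [hN : N.Normal] (hne : N ≠ ⊥) :
    ∃ n, levelStab n ≤ N := by
  obtain ⟨g, hg, hg1⟩ := N.bot_or_exists_ne_one.resolve_left hne
  obtain ⟨v, -, hv⟩ := exists_apply_ne hg1 0
  -- Double commutator trick: g moves v, so the conjugate Z of X by g commutes with X and Y, which
  -- are supported below v. Then [ZX⁻¹, Y] = [X⁻¹, Y], and ZX⁻¹ = [g, X] lies in N. Thus N contains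
  -- every element of G'' placed at v.
  have base : ⁅commutator G, commutator G⁆ ≤
      (⟨⟨⟨{ζ | ∃ η ∈ N, IsPlaced v ζ η}, fun ⟨η, h, hp⟩ ⟨η', h', hp'⟩ =>
        ⟨η * η', mul_mem h h', hp.mul hp'⟩⟩, ⟨1, one_mem _, isPlaced_one v⟩⟩,
        fun ⟨η, h, hp⟩ => ⟨η⁻¹, inv_mem h, hp.inv⟩⟩ : Subgroup G) := by
    rw [Subgroup.commutator_le]
    intro ξ hξ ζ hζ
    obtain ⟨X, -, hX⟩ := exists_isPlaced v (inv_mem hξ)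
    obtain ⟨Y, -, hY⟩ := exists_isPlaced v hζ
    set Z := g * X * g⁻¹ with hZdef
    have hZ := hX.conj g
    rw [← hZdef] at hZ
    have hZY : Commute Z Y := hZ.commute hY (length_apply _ _) hv
    have hZX : Commute Z X := hZ.commute hX (length_apply _ _) hv
    have hmem : ⁅Z * X⁻¹, Y⁆ ∈ N := by
      have h1 : Z * X⁻¹ ∈ N := by
        rw [hZdef, mul_assoc, mul_assoc]
        refine mul_mem hg ?_
        rw [← mul_assoc]
        exact hN.conj_mem _ (inv_mem hg) X
      rw [commutatorElement_def, mul_assoc, mul_assoc]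
      refine mul_mem h1 ?_
      rw [← mul_assoc]
      exact hN.conj_mem _ (inv_mem h1) Y
    have heq : ⁅Z * X⁻¹, Y⁆ = ⁅X⁻¹, Y⁆ := by
      have h2 : Commute Z ⁅X⁻¹, Y⁆ := by
        rw [commutatorElement_def]
        exact ((hZX.inv_right.mul_right hZY).mul_right hZX.inv_right.inv_right).mul_right
          hZY.inv_right
      have h3 : ⁅Z * X⁻¹, Y⁆ = Z * ⁅X⁻¹, Y⁆ * (Y * Z⁻¹ * Y⁻¹) := by
        simp only [commutatorElement_def]
        group
      rw [h3, h2.eq, hZY.symm.inv_right.eq]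
      group
    rw [heq] at hmem
    refine ⟨_, hmem, ?_⟩
    have := hX.inv.commutatorElement hY
    rwa [inv_inv] at this
  refine ⟨v.length + 4, fun k hk => ?_⟩
  -- G'' contains the stabilizer of level 4, and conjugation carries v to every vertex of its level.
  rw [mem_levelStab_add] at hk
  refine mem_of_isPlaced hk.1 fun u hu => ?_
  obtain ⟨s, rfl⟩ := exists_apply_eq v u hu.symm
  have hmem := levelStab_four_le (hk.2 _ hu)
  have hnorm : (⁅commutator G, commutator G⁆ : Subgroup G).Normal := inferInstance
  have := hnorm.conj_mem _ hmem (secw s v)⁻¹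
  obtain ⟨η, hη, hp⟩ := base this
  refine ⟨s * η * s⁻¹, hN.conj_mem _ hη s, ?_⟩
  have h5 := hp.conj s
  convert h5 using 1
  group

theorem exists_mem_levelStab_two_secw_eq {v : Vertex} (hv : v.length = 2) (g : G) :
    ∃ h ∈ levelStab 2, secw h v = g := by
  let P : Subgroup G :=
    { carrier := {g | ∃ h ∈ levelStab 2, secw h v = g}
      one_mem' := ⟨1, one_mem _, secw_one v⟩
      mul_mem' := by
        rintro _ _ ⟨h, hh, rfl⟩ ⟨k, hk, rfl⟩
        exact ⟨h * k, mul_mem hh hk, by rw [secw_mul, apply_eq_of_mem_levelStab hk hv.le]⟩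
      inv_mem' := by
        rintro _ ⟨h, hh, rfl⟩
        exact ⟨h⁻¹, inv_mem hh, secw_inv hh hv⟩ }
  have hcomm : commutator G ≤ P := by
    intro ξ hξ
    obtain ⟨η, -, hη⟩ := exists_isPlaced v hξ
    exact ⟨η, hv ▸ hη.1, by simpa using hη.2 v rfl⟩
  -- The witness is b₀b₁b₂ = (aba⁻¹, b, b). Below the letter 1 its second-level sections are a, a⁻¹,
  -- b; conjugating moves conjugates of these to v, and together with G' they give all of G.
  obtain ⟨c, hc, hc1⟩ : ∃ c ∈ levelStab 2, sec c 1 = gb := by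
    have h1 : rho (ga ^ 1) = 1 := rho_pow_ga 1
    have h2 : rho (ga ^ 2) = 2 := rho_pow_ga 2
    have hs : ∀ y, sec (gb * (ga ^ 1 * gb * (ga ^ 1)⁻¹) * (ga ^ 2 * gb * (ga ^ 2)⁻¹)) y =
        sec gb y * sec gb (y - 1) * sec gb (y - 2) := by
      intro y
      rw [sec_mul, sec_mul, rho_conj_pow_ga, rho_conj_pow_ga, sec_conj_pow_ga, sec_conj_pow_ga, h1, h2, add_zero, add_zero]
    refine ⟨gb * (ga ^ 1 * gb * (ga ^ 1)⁻¹) * (ga ^ 2 * gb * (ga ^ 2)⁻¹), ⟨?_, fun x => ?_⟩, ?_⟩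
    · rw [rho_mul, rho_mul, rho_conj_pow_ga, rho_conj_pow_ga, rho_gb, add_zero, add_zero]
    · rw [hs, mem_levelStab_one]
      fin_cases x
      · simp [show (-1 : Fin 3) = 2 from rfl, show (-2 : Fin 3) = 1 from rfl, rho_mul]
      · simp [show (1 - 2 : Fin 3) = 2 from rfl]
      · simp [show (2 - 1 : Fin 3) = 1 from rfl]
    · rw [hs]
      simp [show (1 - 2 : Fin 3) = 2 from rfl]
  have hmem : ∀ x, ∃ p ∈ P, rho p = rho (sec gb x) ∧ beta p = beta (sec gb x) := by
    intro x
    obtain ⟨s, rfl⟩ := exists_apply_eq [1, x] v hv.symm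
    refine ⟨_, ⟨s * c * s⁻¹, (levelStab_normal 2).conj_mem _ hc s, secw_conj s hc⟩, ?_⟩
    simp only [secw_cons, secw_nil, hc1, rho_mul, rho_inv, beta_mul, beta_inv,
      add_neg_cancel_comm, and_self]
  obtain ⟨p, hp, hpr, hpb⟩ := hmem 0
  obtain ⟨q, hq, hqr, hqb⟩ := hmem 2
  simp only [sec_gb_zero, sec_gb_two, rho_ga, beta_ga, rho_gb, beta_gb] at hpr hpb hqr hqb
  have hpow : ∀ x y : Fin 3, rho (p ^ x.val * q ^ y.val) = x ∧ beta (p ^ x.val * q ^ y.val) = y := by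
    intro x y
    fin_cases x <;> fin_cases y <;>
      simp [pow_succ, rho_mul, beta_mul, hpr, hpb, hqr, hqb]
  obtain ⟨h1, h2⟩ := hpow (rho g) (beta g)
  have hg : (p ^ (rho g).val * q ^ (beta g).val)⁻¹ * g ∈ P := hcomm <| mem_commutator_iff.2
    ⟨by rw [rho_mul, rho_inv, h1, neg_add_cancel], by rw [beta_mul, beta_inv, h2, neg_add_cancel]⟩
  have := mul_mem (mul_mem (pow_mem hp (rho g).val) (pow_mem hq (beta g).val)) hg
  rwa [mul_inv_cancel_left] at this

/-- From level 2 on the stabilizers lie in G', so their elements can be placed one level deeper. -/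
theorem exists_mem_levelStab_secw_eq {v : Vertex} (hv : 2 ≤ v.length) (g : G) :
    ∃ h ∈ levelStab v.length, secw h v = g := by
  induction v with
  | nil => simp at hv
  | cons x v ih =>
    rcases hv.eq_or_lt with h2 | h2
    · rw [← h2]
      exact exists_mem_levelStab_two_secw_eq h2.symm g
    · have hlen : 2 ≤ v.length := by simpa [Nat.lt_succ_iff] using h2
      obtain ⟨h, hh, rfl⟩ := ih hlen
      obtain ⟨k, -, hr, hs⟩ :=
        commutator_le_copyAt x (levelStab_two_le (levelStab_antitone hlen hh))
      refine ⟨k, ⟨hr, fun y => ?_⟩, by rw [secw_cons, hs, Pi.mulSingle_eq_same]⟩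
      rw [hs]
      by_cases hy : y = x
      · subst hy
        rw [Pi.mulSingle_eq_same]
        exact hh
      · rw [Pi.mulSingle_eq_of_ne hy]
        exact one_mem _

theorem exists_mem_commutator_ne_one : ∃ g ∈ commutator G, g ≠ 1 := by
  refine ⟨ga * gb * ga⁻¹ * gb⁻¹, mem_commutator_iff.2 ⟨?_, ?_⟩, fun h => ?_⟩
  · simp [rho_mul]
  · simp [beta_mul]
  · have h0 : rho (sec (ga * gb * ga⁻¹ * gb⁻¹) 0) = 0 := by rw [h, sec_one, rho_one]
    simp [sec_mul, sec_inv, rho_mul, show (-1 : Fin 3) = 2 from rfl] at h0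

/-- If g moves v, conjugation by g moves the support of an element of G' placed at v. -/
theorem eq_one_of_commute_commutator {g : G} (hg : ∀ ξ ∈ commutator G, Commute g ξ) : g = 1 := by
  by_contra hne
  obtain ⟨v, -, hv⟩ := exists_apply_ne hne 0
  obtain ⟨ξ, hξ, hξ1⟩ := exists_mem_commutator_ne_one
  obtain ⟨η, hη, hp⟩ := exists_isPlaced v hξ
  have h1 := (hp.conj g).2 v (length_apply g v).symm
  rw [(hg η hη).eq, mul_inv_cancel_right, hp.2 v rfl, if_pos rfl, if_neg (Ne.symm hv)] at h1
  exact hξ1 h1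

/-- The proper subgroup fixing the first level maps onto G by taking a section. -/
instance infinite_G : Infinite G := by
  by_contra hfin
  rw [not_infinite_iff_finite] at hfin
  choose f hf hs using exists_mem_levelStab_one_sec_eq 0
  have hinj : Function.Injective f := fun g h hgh => by rw [← hs g, hgh, hs]
  obtain ⟨g, hg⟩ := Finite.surjective_of_injective hinj ga
  have := mem_levelStab_one.1 (hf g)
  rw [hg, rho_ga] at this
  exact absurd this (by decide)

/-! ### Finite index under homomorphisms -/

theorem finiteIndex_map {Γ Δ : Type*} [Group Γ] [Group Δ] (f : Γ →* Δ) [hf : f.range.FiniteIndex]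
    (H : Subgroup Γ) [H.FiniteIndex] : (H.map f).FiniteIndex := by
  have : (H ⊔ f.ker).FiniteIndex := Subgroup.finiteIndex_of_le (le_sup_left (a := H))
  refine ⟨?_⟩
  rw [Subgroup.index_map]
  exact mul_ne_zero this.index_ne_zero hf.index_ne_zero

theorem finiteIndex_comap {Γ Δ : Type*} [Group Γ] [Group Δ] (f : Γ →* Δ) (H : Subgroup Δ)
    [H.FiniteIndex] : (H.comap f).FiniteIndex := by
  refine ⟨?_⟩
  rw [Subgroup.index_comap]
  exact (inferInstance : (H.subgroupOf f.range).FiniteIndex).index_ne_zero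

theorem finiteIndex_prod {Γ Δ : Type*} [Group Γ] [Group Δ] (H : Subgroup Γ) (K : Subgroup Δ)
    [H.FiniteIndex] [K.FiniteIndex] : (H.prod K).FiniteIndex := by
  have h1 := finiteIndex_comap (MonoidHom.fst Γ Δ) H
  have h2 := finiteIndex_comap (MonoidHom.snd Γ Δ) K
  exact (inferInstance : (H.comap (MonoidHom.fst Γ Δ) ⊓ K.comap (MonoidHom.snd Γ Δ)).FiniteIndex)

theorem finiteIndex_range_comp {Γ Δ Θ : Type*} [Group Γ] [Group Δ] [Group Θ] (g : Δ →* Θ)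
    (f : Γ →* Δ) [g.range.FiniteIndex] [f.range.FiniteIndex] : (g.comp f).range.FiniteIndex := by
  rw [← MonoidHom.map_range]
  exact finiteIndex_map g f.range

theorem finiteIndex_range_of_surjective {Γ Δ : Type*} [Group Γ] [Group Δ] {f : Γ →* Δ}
    (hf : Function.Surjective f) : f.range.FiniteIndex := by
  rw [MonoidHom.range_eq_top.2 hf]
  infer_instance

/-- The section at a vertex of the first level, on the stabilizer of the first level. -/
noncomputable def secHom (x : Fin 3) : levelStab 1 →* G where
  toFun g := sec g x
  map_one' := sec_one x
  map_mul' g h := by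
    change sec (g * h : G) x = _
    rw [sec_mul, h.2.1, add_zero]

instance finiteIndex_levelStab (n : ℕ) : (levelStab n).FiniteIndex := by
  have h1 : (levelStab 1).FiniteIndex := by
    have : levelStab 1 = rhoHom.ker := by
      ext g
      exact mem_levelStab_one
    rw [this]
    have : Finite (Multiplicative (Fin 3)) := inferInstanceAs (Finite (Fin 3))
    infer_instance
  induction n with
  | zero => exact inferInstanceAs (⊤ : Subgroup G).FiniteIndex
  | succ n ih =>
    have heq : levelStab (n + 1) =
        (⨅ x, (levelStab n).comap (secHom x)).map (levelStab 1).subtype := by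
      ext g
      constructor
      · intro hg
        exact ⟨⟨g, mem_levelStab_one.2 hg.1⟩, Subgroup.mem_iInf.2 fun x => hg.2 x, rfl⟩
      · rintro ⟨g, hg, rfl⟩
        exact ⟨g.2.1, fun x => Subgroup.mem_iInf.1 hg x⟩
    rw [heq]
    have : (levelStab 1).subtype.range.FiniteIndex := by rwa [Subgroup.range_subtype]
    have : (⨅ x, (levelStab n).comap (secHom x)).FiniteIndex :=
      Subgroup.finiteIndex_iInf fun x => finiteIndex_comap _ _
    exact finiteIndex_map _ _

theorem finiteIndex_of_normal {N : Subgroup G} [N.Normal] (hne : N ≠ ⊥) : N.FiniteIndex := by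
  obtain ⟨n, hn⟩ := exists_levelStab_le hne
  exact Subgroup.finiteIndex_of_le hn

theorem exists_levelStab_le_of_finiteIndex (L : Subgroup G) [L.FiniteIndex] :
    ∃ n, 2 ≤ n ∧ levelStab n ≤ L := by
  have hne : L.normalCore ≠ ⊥ := by
    intro h
    have hfin : (⊥ : Subgroup G).FiniteIndex := h ▸ inferInstance
    have hf : Finite (G ⧸ (⊥ : Subgroup G)) := inferInstance
    have := Finite.of_equiv _ (QuotientGroup.quotientBot (G := G)).toEquiv
    exact not_finite G
  obtain ⟨n, hn⟩ := exists_levelStab_le hne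
  exact ⟨max n 2, le_max_right _ _,
    (levelStab_antitone (le_max_left _ _)).trans (hn.trans L.normalCore_le)⟩

end GuptaSidki

/-! ### Abstract commensurability -/

namespace AbstractlyCommensurable

variable {H K L P : Type*} [Group H] [Group K] [Group L] [Group P]

theorem of_hom (f : P →* H) (g : P →* K) (hf : Function.Injective f) (hg : Function.Injective g)
    (hf' : f.range.FiniteIndex) (hg' : g.range.FiniteIndex) : AbstractlyCommensurable H K :=
  ⟨f.range, g.range, hf', hg',
    ⟨(MonoidHom.ofInjective hf).symm.trans (MonoidHom.ofInjective hg)⟩⟩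

theorem of_injective (f : H →* K) (hf : Function.Injective f) (hf' : f.range.FiniteIndex) :
    AbstractlyCommensurable H K :=
  of_hom (MonoidHom.id H) f Function.injective_id hf
    (GuptaSidki.finiteIndex_range_of_surjective Function.surjective_id) hf'

theorem of_mulEquiv (e : H ≃* K) : AbstractlyCommensurable H K :=
  of_injective e.toMonoidHom e.injective (GuptaSidki.finiteIndex_range_of_surjective e.surjective)

theorem symm : AbstractlyCommensurable H K → AbstractlyCommensurable K H := by
  rintro ⟨A, B, hA, hB, ⟨e⟩⟩
  exact ⟨B, A, hB, hA, ⟨e.symm⟩⟩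

theorem of_subgroup (A : Subgroup H) [hA : A.FiniteIndex] : AbstractlyCommensurable H A :=
  (of_injective A.subtype A.subtype_injective (by rwa [Subgroup.range_subtype])).symm

theorem _root_.GuptaSidki.injective_and_finiteIndex_range_of_le {D : Subgroup H}
    {E F : Subgroup K} (i : E ≃* D) (hFE : F ≤ E) (hD : D.FiniteIndex) (hF : F.FiniteIndex) :
    Function.Injective ((D.subtype.comp i.toMonoidHom).comp (Subgroup.inclusion hFE)) ∧
      ((D.subtype.comp i.toMonoidHom).comp (Subgroup.inclusion hFE)).range.FiniteIndex := by
  refine ⟨(D.subtype_injective.comp i.injective).comp (Subgroup.inclusion_injective hFE), ?_⟩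
  have h1 : D.subtype.range.FiniteIndex := by rwa [Subgroup.range_subtype]
  have h2 : i.toMonoidHom.range.FiniteIndex :=
    GuptaSidki.finiteIndex_range_of_surjective i.surjective
  have h3 := GuptaSidki.finiteIndex_range_comp D.subtype i.toMonoidHom
  have h4 : (Subgroup.inclusion hFE).range.FiniteIndex := by
    rw [Subgroup.inclusion_range]
    infer_instance
  exact GuptaSidki.finiteIndex_range_comp _ _

theorem trans (h : AbstractlyCommensurable H K) (h' : AbstractlyCommensurable K L) :
    AbstractlyCommensurable H L := by
  obtain ⟨A, B, hA, hB, ⟨e⟩⟩ := h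
  obtain ⟨B', C, hB', hC, ⟨e'⟩⟩ := h'
  have hBB : (B ⊓ B').FiniteIndex := inferInstance
  obtain ⟨f1, f2⟩ :=
    GuptaSidki.injective_and_finiteIndex_range_of_le e.symm inf_le_left hA hBB
  obtain ⟨g1, g2⟩ := GuptaSidki.injective_and_finiteIndex_range_of_le e' inf_le_right hC hBB
  exact of_hom _ _ f1 g1 f2 g2

theorem prod {H' K' : Type*} [Group H'] [Group K'] (h : AbstractlyCommensurable H K)
    (h' : AbstractlyCommensurable H' K') : AbstractlyCommensurable (H × H') (K × K') := by
  obtain ⟨A, B, hA, hB, ⟨e⟩⟩ := h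
  obtain ⟨A', B', hA', hB', ⟨e'⟩⟩ := h'
  exact ⟨A.prod A', B.prod B', GuptaSidki.finiteIndex_prod A A', GuptaSidki.finiteIndex_prod B B',
    ⟨(Subgroup.prodEquiv A A').trans ((MulEquiv.prodCongr e e').trans
      (Subgroup.prodEquiv B B').symm)⟩⟩

end AbstractlyCommensurable

/-! ### Groups commensurable with powers of G -/

namespace GuptaSidki

open scoped commutatorElement

/-- Functions on a disjoint union. -/
def sumArrowMulEquiv (α β M : Type*) [Mul M] : (α ⊕ β → M) ≃* (α → M) × (β → M) where
  toEquiv := Equiv.sumArrowEquivProdArrow α β M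
  map_mul' _ _ := rfl

/-- Groups commensurable with a finite power of the Gupta–Sidki group. -/
def IsVirtualPower (H : Type) [Group H] : Prop :=
  ∃ (ι : Type) (_ : Finite ι), AbstractlyCommensurable H (ι → G)

theorem IsVirtualPower.of_commensurable {H K : Type} [Group H] [Group K] (h : IsVirtualPower H)
    (hK : AbstractlyCommensurable K H) : IsVirtualPower K := by
  obtain ⟨ι, hι, h⟩ := h
  exact ⟨ι, hι, hK.trans h⟩

theorem IsVirtualPower.prod {H K : Type} [Group H] [Group K] (hH : IsVirtualPower H)
    (hK : IsVirtualPower K) : IsVirtualPower (H × K) := by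
  obtain ⟨ι, hι, hH⟩ := hH
  obtain ⟨κ, hκ, hK⟩ := hK
  exact ⟨ι ⊕ κ, inferInstance,
    (hH.prod hK).trans (.of_mulEquiv (sumArrowMulEquiv ι κ G).symm)⟩

theorem isVirtualPower_of_finite (H : Type) [Group H] [Finite H] : IsVirtualPower H :=
  ⟨Empty, inferInstance, ⊥, ⊥, inferInstance, inferInstance, ⟨MulEquiv.ofUnique⟩⟩

theorem finiteIndex_pi {ι : Type*} [Finite ι] {Γ : Type*} [Group Γ] (D : ι → Subgroup Γ)
    (hD : ∀ i, (D i).FiniteIndex) : (Subgroup.pi Set.univ D).FiniteIndex := by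
  have : Subgroup.pi Set.univ D = ⨅ i, (D i).comap (Pi.evalMonoidHom (fun _ => Γ) i) := by
    ext x
    simp [Subgroup.mem_pi, Subgroup.mem_iInf]
  rw [this]
  exact Subgroup.finiteIndex_iInf fun i => finiteIndex_comap _ _

/-- A normal subgroup of a group which maps onto the stabilizer of a level has image of finite
index in the product of its nontrivial sections. -/
theorem finiteIndex_map_sections {H : Type} [Group H] {n : ℕ} (hn : 2 ≤ n) (r : H →* levelStab n)
    (hr : Function.Surjective r) (K : Subgroup H) [hK : K.Normal]
    {V : Set (List.Vector (Fin 3) n)} (hV : ∀ v ∈ V, ∃ m ∈ K, sections n (r m) v ≠ 1) :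
    (K.map (MonoidHom.pi fun v : V =>
      (Pi.evalMonoidHom (fun _ => G) v.1).comp ((sections n).comp r))).FiniteIndex := by
  classical
  set q : H →* (V → G) := MonoidHom.pi fun v : V =>
      (Pi.evalMonoidHom (fun _ => G) v.1).comp ((sections n).comp r) with hq
  let R : V → Subgroup G := fun v => K.map ((Pi.evalMonoidHom (fun _ => G) v).comp q)
  -- Normal in all of G, because for n ≥ 2 every element of G is a section at v of the stabilizer of
  -- level n.
  have hRn : ∀ v, (R v).Normal := by
    intro v
    refine hK.map _ fun g => ?_
    obtain ⟨h, hh, hg⟩ := exists_mem_levelStab_secw_eq (v := v.1.1) (by rw [v.1.2]; exact hn) g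
    rw [v.1.2] at hh
    obtain ⟨k, hk⟩ := hr ⟨h, hh⟩
    refine ⟨k, ?_⟩
    change secw (r k) v.1.1 = g
    rw [hk]
    exact hg
  -- R v is nontrivial and G' has trivial centralizer, so the commutator is a nontrivial normal
  -- subgroup.
  have hD : ∀ v, (⁅R v, commutator G⁆ : Subgroup G).FiniteIndex := by
    intro v
    refine finiteIndex_of_normal fun hbot => ?_
    obtain ⟨m, hm, hne⟩ := hV v.1 v.2
    refine hne (eq_one_of_commute_commutator fun ξ hξ => ?_)
    rw [← commutatorElement_eq_one_iff_commute, ← Subgroup.mem_bot, ← hbot]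
    exact Subgroup.commutator_mem_commutator ⟨m, hm, rfl⟩ hξ
  have hle : Subgroup.pi Set.univ (fun v => ⁅R v, commutator G⁆) ≤ K.map q := by
    intro x hx
    refine Subgroup.pi_mem_of_mulSingle_mem _ fun v => ?_
    -- If h acts as ξ placed at v, then [m, h] lies in K by normality and its image is [q m v, ξ] at
    -- v and trivial elsewhere.
    have key : ⁅R v, commutator G⁆ ≤ (K.map q).comap (MonoidHom.mulSingle (fun _ => G) v) := by
      rw [Subgroup.commutator_le]
      rintro _ ⟨m, hm, rfl⟩ ξ hξ
      obtain ⟨η, hη, hp⟩ := exists_isPlaced v.1.1 hξ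
      have hη' : η ∈ levelStab n := by simpa [v.1.2] using hp.1
      obtain ⟨h, hh⟩ := hr ⟨η, hη'⟩
      have hqh : q h = Pi.mulSingle v ξ := by
        funext u
        have := congrFun (hp.sections_eq hη') u.1
        rw [← hh] at this
        refine this.trans ?_
        by_cases hu : u = v
        · subst hu
          rw [Pi.mulSingle_eq_same, Pi.mulSingle_eq_same]
        · rw [Pi.mulSingle_eq_of_ne hu, Pi.mulSingle_eq_of_ne fun h => hu (Subtype.ext h)]
      refine ⟨⁅m, h⁆, ?_, ?_⟩
      · rw [commutatorElement_def, mul_assoc, mul_assoc]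
        refine mul_mem hm ?_
        rw [← mul_assoc]
        exact hK.conj_mem _ (inv_mem hm) h
      · rw [map_commutatorElement, hqh]
        funext u
        by_cases hu : u = v
        · subst hu
          simp [commutatorElement_def]
        · simp [commutatorElement_def, hu]
    exact key (hx v trivial)
  have := finiteIndex_pi _ hD
  exact Subgroup.finiteIndex_of_le hle

/-- A group with jointly injective homomorphisms to the Gupta–Sidki group with images of finite
index is commensurable with a power of the Gupta–Sidki group. -/
theorem isVirtualPower_of_homs (N : ℕ) : ∀ (H : Type) [Group H] (p : Fin N → H →* G),
    (∀ h, (∀ i, p i h = 1) → h = 1) → (∀ i, (p i).range.FiniteIndex) → IsVirtualPower H := by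
  induction N with
  | zero =>
    intro H _ p hinj _
    have : Subsingleton H := ⟨fun x y => by
      rw [hinj x fun i => i.elim0, hinj y fun i => i.elim0]⟩
    exact isVirtualPower_of_finite H
  | succ N ih =>
    intro H _ p hinj hp
    have := hp 0
    -- On the finite-index preimage H₀ of this stabilizer, `p 0` maps onto the stabilizer, and n ≥ 2
    -- allows `finiteIndex_map_sections`.
    obtain ⟨n, hn, hle⟩ := exists_levelStab_le_of_finiteIndex (p 0).range
    have hfin : ((levelStab n).comap (p 0)).FiniteIndex := finiteIndex_comap _ _
    generalize hH₀ : (levelStab n).comap (p 0) = H₀ at hfin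
    refine IsVirtualPower.of_commensurable (H := H₀) ?_ (.of_subgroup H₀)
    let r : H₀ →* levelStab n := ((p 0).comp H₀.subtype).codRestrict (levelStab n)
      fun h => by
        have : (h : H) ∈ (levelStab n).comap (p 0) := by
          rw [hH₀]
          exact h.2
        exact this
    have hr : Function.Surjective r := by
      rintro ⟨g, hg⟩
      obtain ⟨h, rfl⟩ := hle hg
      exact ⟨⟨h, hH₀ ▸ hg⟩, rfl⟩
    let p' : Fin N → H₀ →* G := fun i => (p i.succ).comp H₀.subtype
    have hp' : ∀ i, (p' i).range.FiniteIndex := by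
      intro i
      have := hp i.succ
      have : H₀.subtype.range.FiniteIndex := by rwa [Subgroup.range_subtype]
      exact finiteIndex_range_comp _ _
    let K : Subgroup H₀ := ⨅ i, (p' i).ker
    have hK : K.Normal := Subgroup.normal_iInf_normal fun i => inferInstance
    have hKr : ∀ h ∈ K, r h = 1 → h = 1 := by
      intro h hh h1
      refine Subtype.ext (hinj _ fun i => ?_)
      refine Fin.cases ?_ (fun i => ?_) i
      · exact congrArg Subtype.val h1
      · exact Subgroup.mem_iInf.1 hh i
    -- K, the common kernel of the other homomorphisms, is seen faithfully by `p 0`, and hence by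
    -- the sections at the vertices of V.
    let V : Set (List.Vector (Fin 3) n) := {v | ∃ m ∈ K, sections n (r m) v ≠ 1}
    have hmap := finiteIndex_map_sections hn r hr K (V := V) fun v hv => hv
    set q : H₀ →* (V → G) := MonoidHom.pi fun v : V =>
      (Pi.evalMonoidHom (fun _ => G) v.1).comp ((sections n).comp r) with hq
    have hKq : ∀ h ∈ K, q h = 1 → h = 1 := by
      intro h hh h1
      refine hKr h hh (sections_injective n ?_)
      rw [map_one]
      funext v
      by_contra hne
      exact hne (congrFun h1 ⟨v, h, hh, hne⟩)
    have hdisj : Disjoint K q.ker := by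
      rw [Subgroup.disjoint_def]
      exact fun hh h1 => hKq _ hh h1
    -- This is the preimage of q(K). So H₀ is virtually K × ker q, where K is virtually a power of
    -- G.
    have hsup : (K ⊔ q.ker).FiniteIndex := by
      rw [← Subgroup.comap_map_eq]
      exact finiteIndex_comap _ _
    have hKpow : IsVirtualPower K := by
      refine ⟨V, inferInstance, .of_injective (q.comp K.subtype) ?_ ?_⟩
      · rw [injective_iff_map_eq_one]
        exact fun h h1 => Subtype.ext (hKq _ h.2 h1)
      · rwa [← MonoidHom.map_range, Subgroup.range_subtype]
    -- The remaining N homomorphisms are jointly injective on ker q. They kill K, so the images of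
    -- ker q are those of K · ker q and have finite index.
    have hCpow : IsVirtualPower q.ker := by
      refine ih q.ker (fun i => (p' i).comp q.ker.subtype) (fun h h1 => ?_) fun i => ?_
      · exact Subtype.ext (hKq _ (Subgroup.mem_iInf.2 h1) h.2)
      · have hbot : K.map (p' i) = ⊥ := by
          rw [Subgroup.map_eq_bot_iff]
          exact iInf_le _ i
        have := hp' i
        have := finiteIndex_map (p' i) (K ⊔ q.ker)
        rwa [Subgroup.map_sup, hbot, bot_sup_eq, ← Subgroup.range_subtype q.ker,
          MonoidHom.map_range] at this
    have hcomm : ∀ (k : K) (c : q.ker), Commute (K.subtype k) (q.ker.subtype c) := fun k c =>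
      Subgroup.commute_of_normal_of_disjoint _ _ hK inferInstance hdisj _ _ k.2 c.2
    refine (hKpow.prod hCpow).of_commensurable
      (AbstractlyCommensurable.of_injective (MonoidHom.noncommCoprod _ _ hcomm) ?_ ?_).symm
    · rw [MonoidHom.noncommCoprod_injective, Subgroup.range_subtype, Subgroup.range_subtype]
      exact ⟨K.subtype_injective, q.ker.subtype_injective, hdisj⟩
    · rwa [MonoidHom.noncommCoprod_range, Subgroup.range_subtype, Subgroup.range_subtype]

/-- For sections, the coordinates of all three virtual powers give homomorphisms from a finite-index
subgroup of H to G. They are jointly injective, because an element fixing the first level is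
determined by its sections. -/
theorem isInductive_isVirtualPower : IsInductive fun H => IsVirtualPower H where
  finite H _ := isVirtualPower_of_finite H
  top := ⟨Unit, inferInstance,
    .of_mulEquiv (Subgroup.topEquiv.trans (MulEquiv.funUnique Unit G).symm)⟩
  conj H g h := h.of_commensurable
    (.of_mulEquiv (H.equivMapOfInjective _ (MulAut.conj g).injective).symm)
  of_section H h := by
    choose ι hι A B hA hB he using h
    replace he := fun x => (he x).some
    let H₁ := (levelStab 1).subgroupOf H
    have hπmem : ∀ x (g : H₁), sec g x ∈ sectionSubgroup H x := fun x g =>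
      ⟨g, g.1.2, mem_levelStab_one.1 g.2, rfl⟩
    have hrho : ∀ g : H₁, rho g = 0 := fun g => mem_levelStab_one.1 g.2
    let π : ∀ x, H₁ →* sectionSubgroup H x := fun x =>
      { toFun := fun g => ⟨sec g x, hπmem x g⟩
        map_one' := Subtype.ext (sec_one x)
        map_mul' := fun g h => Subtype.ext <| by
          change sec (g * h : G) x = sec g x * sec h x
          rw [sec_mul, hrho, add_zero] }
    have hπ : ∀ x, Function.Surjective (π x) := by
      rintro x ⟨_, g, hg, hr, rfl⟩
      exact ⟨⟨⟨g, hg⟩, mem_levelStab_one.2 hr⟩, rfl⟩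
    have hfin : (⨅ x, (A x).comap (π x)).FiniteIndex :=
      Subgroup.finiteIndex_iInf fun x => finiteIndex_comap _ _
    generalize hH₀ : (⨅ x, (A x).comap (π x)) = H₀ at hfin
    have hmem : ∀ x (h : H₀), π x h ∈ A x := by
      intro x h
      have : (h : H₁) ∈ ⨅ x, (A x).comap (π x) := by
        rw [hH₀]
        exact h.2
      exact Subgroup.mem_iInf.1 this x
    refine IsVirtualPower.of_commensurable (H := H₀) ?_
      ((AbstractlyCommensurable.of_subgroup H₁).trans (.of_subgroup H₀))
    let ρ : ∀ x, H₀ →* A x := fun x => ((π x).comp H₀.subtype).codRestrict (A x) (hmem x)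
    have hρ : ∀ x, (ρ x).range.FiniteIndex := by
      intro x
      have : (π x).range.FiniteIndex := finiteIndex_range_of_surjective (hπ x)
      have hmap := finiteIndex_map (π x) H₀
      have heq : (ρ x).range = (H₀.map (π x)).subgroupOf (A x) := by
        ext y
        constructor
        · rintro ⟨h, rfl⟩
          exact ⟨h, h.2, rfl⟩
        · rintro ⟨h, hh, hy⟩
          exact ⟨⟨h, hh⟩, Subtype.ext hy⟩
      rw [heq]
      infer_instance
    let P : (Σ x, ι x) → H₀ →* G := fun j =>
      (Pi.evalMonoidHom (fun _ => G) j.2).comp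
        ((B j.1).subtype.comp ((he j.1).toMonoidHom.comp (ρ j.1)))
    have hP : ∀ j, (P j).range.FiniteIndex := by
      intro j
      have := hρ j.1
      have : (he j.1).toMonoidHom.range.FiniteIndex :=
        finiteIndex_range_of_surjective (he j.1).surjective
      have : ((he j.1).toMonoidHom.comp (ρ j.1)).range.FiniteIndex := finiteIndex_range_comp _ _
      have : (B j.1).subtype.range.FiniteIndex := by
        rw [Subgroup.range_subtype]
        exact hB j.1
      have : ((B j.1).subtype.comp ((he j.1).toMonoidHom.comp (ρ j.1))).range.FiniteIndex :=
        finiteIndex_range_comp _ _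
      have : (Pi.evalMonoidHom (fun _ : ι j.1 => G) j.2).range.FiniteIndex :=
        finiteIndex_range_of_surjective fun g => ⟨fun _ => g, rfl⟩
      exact finiteIndex_range_comp _ _
    have hinj : ∀ h, (∀ j, P j h = 1) → h = 1 := by
      intro h h1
      have hx : ∀ x, sec (h : H₁) x = 1 := by
        intro x
        have h2 : he x (ρ x h) = 1 := Subtype.ext (funext fun j => h1 ⟨x, j⟩)
        rw [MulEquiv.map_eq_one_iff] at h2
        exact congrArg (fun y : A x => (y : G)) h2
      refine Subtype.ext (Subtype.ext (Subtype.ext (ext_sec ?_ fun x => ?_)))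
      · change rho (h : H₁) = rho 1
        rw [hrho, rho_one]
      · exact (hx x).trans (sec_one x).symm
    obtain ⟨N, ⟨e⟩⟩ := Finite.exists_equiv_fin (Σ x, ι x)
    exact isVirtualPower_of_homs N H₀ (fun i => P (e.symm i))
      (fun h h1 => hinj h fun j => by simpa using h1 (e j)) fun i => hP _

/-- The first-level stabilizer embeds in G³ with image containing (G')³. -/
theorem commensurable_fin_three : AbstractlyCommensurable (Fin 3 → G) G := by
  classical
  let ψ : levelStab 1 →* (Fin 3 → G) := MonoidHom.pi secHom
  refine ((AbstractlyCommensurable.of_subgroup (levelStab 1)).trans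
    (.of_injective ψ ?_ ?_)).symm
  · rw [injective_iff_map_eq_one]
    intro g hg
    refine Subtype.ext (ext_sec ?_ fun x => ?_)
    · exact (mem_levelStab_one.1 g.2).trans rho_one.symm
    · exact (congrFun hg x).trans (sec_one x).symm
  · have := finiteIndex_pi (fun _ : Fin 3 => commutator G) fun _ => inferInstance
    refine Subgroup.finiteIndex_of_le (H := Subgroup.pi Set.univ fun _ => commutator G) ?_
    intro x hx
    refine Subgroup.pi_mem_of_mulSingle_mem _ fun i => ?_
    obtain ⟨h, -, hr, hs⟩ := commutator_le_copyAt i (hx i trivial)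
    exact ⟨⟨h, mem_levelStab_one.2 hr⟩, hs⟩

theorem commensurable_fin_succ (m : ℕ) : AbstractlyCommensurable (Fin (m + 1) → G) G ∨
    AbstractlyCommensurable (Fin (m + 1) → G) (G × G) := by
  induction m using Nat.strong_induction_on with
  | _ m ih =>
  match m with
  | 0 => exact Or.inl (.of_mulEquiv (MulEquiv.funUnique (Fin 1) G))
  | 1 => exact Or.inr (.of_mulEquiv { piFinTwoEquiv (fun _ => G) with map_mul' := fun _ _ => rfl })
  | m + 2 =>
    have split : ∀ k l, AbstractlyCommensurable (Fin (k + l) → G) ((Fin k → G) × (Fin l → G)) :=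
      fun k l => .of_mulEquiv ((MulEquiv.arrowCongr finSumFinEquiv.symm (MulEquiv.refl G)).trans
        (sumArrowMulEquiv _ _ _))
    have h1 : AbstractlyCommensurable (Fin 3 → G) (Fin 1 → G) :=
      commensurable_fin_three.trans (.of_mulEquiv (MulEquiv.funUnique (Fin 1) G).symm)
    -- Trading three factors for one lowers the exponent by two.
    have h2 : AbstractlyCommensurable (Fin (m + 2 + 1) → G) (Fin (m + 1) → G) :=
      ((split m 3).trans ((AbstractlyCommensurable.of_mulEquiv (MulEquiv.refl _)).prod h1)).trans
        (split m 1).symm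
    exact (ih m (by omega)).imp h2.trans h2.trans

end GuptaSidki

theorem theorem1 (H : Subgroup GuptaSidki.G) (hfg : H.FG) (hinf : Infinite H) :
    AbstractlyCommensurable H GuptaSidki.G ∨
      AbstractlyCommensurable H (GuptaSidki.G × GuptaSidki.G) := by
  obtain ⟨ι, hι, h⟩ := GuptaSidki.isInductive_isVirtualPower.mem_of_fg H hfg
  obtain ⟨n, ⟨e⟩⟩ := Finite.exists_equiv_fin ι
  have h := h.trans (.of_mulEquiv (MulEquiv.arrowCongr e (MulEquiv.refl GuptaSidki.G)))
  cases n with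
  | zero =>
    -- The zeroth power is trivial, which would make H finite.
    obtain ⟨A, B, hA, hB, ⟨f⟩⟩ := h
    have : Finite A := Finite.of_equiv _ f.symm.toEquiv
    have : Finite H := (Subgroup.finite_iff_finite_and_finiteIndex A).2 ⟨inferInstance, hA⟩
    exact (not_finite H).elim
  | succ m => exact (GuptaSidki.commensurable_fin_succ m).imp h.trans h.trans
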